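/- **Definitions.** Let $E$ be a locally compact separable metric space and $m$ a Radon measure on $E$ with full support. A *Dirichlet form* $(\mathcal E,\mathcal F)$ on the real space $L^2(E,m)$ is a symmetric, non-negative definite bilinear form $\mathcal E$ on a dense linear subspace $\mathcal F\subset L^2(E,m)$ that is closed ($\mathcal F$ is complete for the norm $\mathcal E_1(u,u)^{1/2}$, where $\mathcal E_1(u,v)=\mathcal E(u,v)+(u,v)_{L^2(E,m)}$) and Markovian (if $u\in\mathcal F$, then $v=\min(\max(u,0),1)\in\mathcal F$ and $\mathcal E(v,v)\le\mathcal E(u,u)$). It is *regular* if $\mathcal F\cap C_{\mathrm c}(E)$ is dense in $\mathcal F$ for the norm $\mathcal E_1^{1/2}$ and dense in $C_{\mathrm c}(E)$ for the uniform norm. If $(\mathcal E,\mathcal F)$ and $(\mathcal E',\mathcal F')$ are regular Dirichlet forms on $L^2(E,m)$, then $(\mathcal E',\mathcal F')$ is a *regular subspace* of $(\mathcal E,\mathcal F)$ if $\mathcal F'\subset\mathcal F$ and $\mathcal E(u,v)=\mathcal E'(u,v)$ for all $u,v\in\mathcal F'$; it is *proper* if moreover $\mathcal F'\ne\mathcal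 F$. A domain (non-empty connected open set) $\Gamma\subset\mathbf R^d$, $d\ge 1$, has *continuous boundary* if every $x\in\partial\Gamma$ has a neighbourhood $U$ such that $$\Gamma\cap U=\{(x_1,\dots,x_d): x_d>F(x_1,\dots,x_{d-1})\}\cap U$$ in some Cartesian coordinate system $(x_1,\dots,x_d)$ and for some continuous function $F:\mathbf R^{d-1}\to\mathbf R$. (Then $\partial\Gamma$ has Lebesgue measure zero, so that $L^2(\bar\Gamma)=L^2(\bar\Gamma,1_{\bar\Gamma}(x)\,dx)$ is identified with $L^2(\Gamma)$.) Let $$H^1(\Gamma)=\{u\in L^2(\Gamma):\ \nabla u\in L^2(\Gamma;\mathbf R^d)\},\qquad \mathbf D_\Gamma(u,v)=\int_\Gamma\nabla u\cdot\nabla v\,dx,$$ where $\nabla u$ is the weak gradient. The form $(\tfrac12\mathbf D_\Gamma,H^1(\Gamma))$ on $L^2(\bar\Gamma)$ is the Dirichlet form of the reflecting Brownian motion on $\bar\Gamma$. **Proposition 3.9.** Let $d\ge1$ and let $\Gamma\subset\mathbf R^d$ be a domain with continuous boundary. Then $(\tfrac12\mathbf D_\Gamma,H^1(\Gamma))$,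 a regular Dirichlet form on $L^2(\bar\Gamma)$, has a proper regular subspace: there is a regular Dirichlet form $(\mathcal E',\mathcal F')$ on $L^2(\bar\Gamma)$ with $\mathcal F'\subsetneq H^1(\Gamma)$ and $\mathcal E'(u,v)=\tfrac12\mathbf D_\Gamma(u,v)$ for all $u,v\in\mathcal F'$. -/

import Mathlib

open MeasureTheory Filter Topology
open scoped ContDiff

noncomputable section

/-- A bilinear form `form` with domain `domain`, a linear subspace of the real space `L²(X, m)`. -/
structure L2Form {X : Type*} [MeasurableSpace X] (m : Measure X) where
  domain : Submodule ℝ (Lp ℝ 2 m)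
  form : domain →ₗ[ℝ] domain →ₗ[ℝ] ℝ

namespace L2Form

variable {X : Type*} [MeasurableSpace X] {m : Measure X}

/-- The form `ℰ₁(u, v) = ℰ(u, v) + (u, v)_{L²(m)}`. -/
def formOne (Q : L2Form m) (u v : Q.domain) : ℝ :=
  Q.form u v + inner ℝ (u : Lp ℝ 2 m) (v : Lp ℝ 2 m)

/-- `(ℰ, ℱ)` is a Dirichlet form on `L²(X, m)`: densely defined, symmetric, non-negative definite,
closed (`ℱ` is complete for the norm `ℰ₁^{1/2}`) and Markovian (the unit contraction operates). -/
structure IsDirichletForm (Q : L2Form m) : Prop where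
  dense_domain : Dense (Q.domain : Set (Lp ℝ 2 m))
  symm : ∀ u v : Q.domain, Q.form u v = Q.form v u
  nonneg : ∀ u : Q.domain, 0 ≤ Q.form u u
  closed : ∀ u : ℕ → Q.domain,
    (∀ ε : ℝ, 0 < ε → ∃ N, ∀ k ≥ N, ∀ l ≥ N, Q.formOne (u k - u l) (u k - u l) < ε) →
    ∃ v : Q.domain, Tendsto (fun k => Q.formOne (u k - v) (u k - v)) atTop (𝓝 0)
  markovian : ∀ u : Q.domain, ∃ v : Q.domain,
    (∀ᵐ x ∂m, (v : Lp ℝ 2 m) x = min (max ((u : Lp ℝ 2 m) x) 0) 1) ∧ Q.form v v ≤ Q.form u u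

/-- The Dirichlet form `(ℰ, ℱ)` on `L²(X, m)` is regular: `ℱ ∩ C_c(X)` is `ℰ₁^{1/2}`-dense in `ℱ`
and uniformly dense in `C_c(X)`. -/
structure IsRegularDirichletForm [TopologicalSpace X] (Q : L2Form m) : Prop
    extends IsDirichletForm Q where
  dense_form : ∀ u : Q.domain, ∀ ε : ℝ, 0 < ε → ∃ w : Q.domain,
    (∃ f : X → ℝ, Continuous f ∧ HasCompactSupport f ∧ (w : Lp ℝ 2 m) =ᵐ[m] f) ∧
    Q.formOne (u - w) (u - w) < ε
  dense_uniform : ∀ f : X → ℝ, Continuous f → HasCompactSupport f → ∀ ε : ℝ, 0 < ε →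
    ∃ g : X → ℝ, Continuous g ∧ HasCompactSupport g ∧
      (∃ w : Q.domain, (w : Lp ℝ 2 m) =ᵐ[m] g) ∧ ∀ x, |f x - g x| < ε

/-- `(ℰ', ℱ')` is a regular subspace of `(ℰ, ℱ)`: both are regular Dirichlet forms on `L²(X, m)`,
`ℱ' ⊆ ℱ`, and `ℰ = ℰ'` on `ℱ' × ℱ'`. -/
structure IsRegularSubspace [TopologicalSpace X] (Q' Q : L2Form m) : Prop where
  regular_sub : Q'.IsRegularDirichletForm
  regular : Q.IsRegularDirichletForm
  domain_le : Q'.domain ≤ Q.domain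
  form_eq : ∀ u v : Q'.domain,
    Q.form (Submodule.inclusion domain_le u) (Submodule.inclusion domain_le v) = Q'.form u v

/-- A regular subspace with `ℱ' ≠ ℱ`. -/
def IsProperRegularSubspace [TopologicalSpace X] (Q' Q : L2Form m) : Prop :=
  Q'.IsRegularSubspace Q ∧ Q'.domain ≠ Q.domain

end L2Form

section Reflecting

variable {d : ℕ}

/-- Lebesgue measure on the closed subspace `closure Γ` of `ℝᵈ`. -/
abbrev closureMeasure (Γ : Set (EuclideanSpace ℝ (Fin d))) : Measure (closure Γ) :=
  Measure.comap Subtype.val volume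

/-- `g` is the weak gradient of `u` on the open set `Γ`: for all `φ ∈ C_c^∞(Γ)` and all `i`,
`∫_Γ u ∂ᵢφ dx = - ∫_Γ gᵢ φ dx`. Here `u ∈ L²(closure Γ)` and `g ∈ L²(Γ; ℝᵈ)`. -/
def IsWeakGradient (Γ : Set (EuclideanSpace ℝ (Fin d)))
    (u : Lp ℝ 2 (closureMeasure Γ))
    (g : Lp (EuclideanSpace ℝ (Fin d)) 2 (volume.restrict Γ)) : Prop :=
  ∀ φ : EuclideanSpace ℝ (Fin d) → ℝ, ContDiff ℝ ∞ φ → HasCompactSupport φ → tsupport φ ⊆ Γ →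
    ∀ i : Fin d,
      ∫ y in {y : closure Γ | (y : EuclideanSpace ℝ (Fin d)) ∈ Γ},
          u y * fderiv ℝ φ y (EuclideanSpace.single i 1) ∂(closureMeasure Γ)
        = - ∫ x in Γ, g x i * φ x

theorem integrable_mul_fderiv (Γ : Set (EuclideanSpace ℝ (Fin d)))
    (u : Lp ℝ 2 (closureMeasure Γ)) {φ : EuclideanSpace ℝ (Fin d) → ℝ}
    (hφ : ContDiff ℝ ∞ φ) (hc : HasCompactSupport φ) (v : EuclideanSpace ℝ (Fin d)) :
    Integrable (fun y : closure Γ => u y * fderiv ℝ φ y v) (closureMeasure Γ) := by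
  have h1 : Continuous fun x => fderiv ℝ φ x v := by
    have := hφ.continuous_fderiv (by simp)
    fun_prop
  have h2 : HasCompactSupport fun x => fderiv ℝ φ x v := hc.fderiv_apply (𝕜 := ℝ) v
  have h3 : MemLp (fun x => fderiv ℝ φ x v) 2 (volume.restrict (closure Γ)) :=
    h1.memLp_of_hasCompactSupport h2
  have h4 : MemLp (fun y : closure Γ => fderiv ℝ φ y v) 2 (closureMeasure Γ) := by
    rw [← map_comap_subtype_coe isClosed_closure.measurableSet,
      (MeasurableEmbedding.subtype_coe isClosed_closure.measurableSet).memLp_map_measure_iff] at h3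
    exact h3
  exact (Lp.memLp u).integrable_mul h4

theorem integrable_coord_mul (Γ : Set (EuclideanSpace ℝ (Fin d)))
    (g : Lp (EuclideanSpace ℝ (Fin d)) 2 (volume.restrict Γ)) {φ : EuclideanSpace ℝ (Fin d) → ℝ}
    (hφ : ContDiff ℝ ∞ φ) (hc : HasCompactSupport φ) (i : Fin d) :
    Integrable (fun x => g x i * φ x) (volume.restrict Γ) := by
  have h1 : MemLp φ 2 (volume.restrict Γ) := hφ.continuous.memLp_of_hasCompactSupport hc
  have h2 : MemLp (fun x => g x i) 2 (volume.restrict Γ) :=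
    (EuclideanSpace.proj (𝕜 := ℝ) i).comp_memLp' (Lp.memLp g)
  exact h2.integrable_mul h1

/-- The linear space of all pairs `(u, ∇u)` with `u ∈ L²(closure Γ)` and `∇u ∈ L²(Γ; ℝᵈ)`. -/
def weakGradientGraph (Γ : Set (EuclideanSpace ℝ (Fin d))) :
    Submodule ℝ (Lp ℝ 2 (closureMeasure Γ) ×
      Lp (EuclideanSpace ℝ (Fin d)) 2 (volume.restrict Γ)) where
  carrier := {p | IsWeakGradient Γ p.1 p.2}
  zero_mem' := by
    intro φ hφ hc hs i
    have h1 : ∀ᵐ y ∂((closureMeasure Γ).restrict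
        {y : closure Γ | (y : EuclideanSpace ℝ (Fin d)) ∈ Γ}),
        (0 : Lp ℝ 2 (closureMeasure Γ)) y
          * fderiv ℝ φ y (EuclideanSpace.single i 1) = 0 := by
      filter_upwards [ae_restrict_of_ae (Lp.coeFn_zero ℝ 2 (closureMeasure Γ))]
        with y hy
      rw [hy, Pi.zero_apply, zero_mul]
    have h2 : ∀ᵐ x ∂(volume.restrict Γ),
        (0 : Lp (EuclideanSpace ℝ (Fin d)) 2 (volume.restrict Γ)) x i * φ x = 0 := by
      filter_upwards [Lp.coeFn_zero (EuclideanSpace ℝ (Fin d)) 2 (volume.restrict Γ)] with x hx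
      rw [hx]
      simp
    simp only [Prod.fst_zero, Prod.snd_zero]
    rw [integral_eq_zero_of_ae h1, integral_eq_zero_of_ae h2, neg_zero]
  add_mem' := by
    rintro ⟨u, g⟩ ⟨v, h⟩ hu hv φ hφ hc hs i
    have h1 : ∀ᵐ y ∂((closureMeasure Γ).restrict
        {y : closure Γ | (y : EuclideanSpace ℝ (Fin d)) ∈ Γ}),
        (u + v) y * fderiv ℝ φ y (EuclideanSpace.single i 1)
          = u y * fderiv ℝ φ y (EuclideanSpace.single i 1)
            + v y * fderiv ℝ φ y (EuclideanSpace.single i 1) := by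
      filter_upwards [ae_restrict_of_ae (Lp.coeFn_add u v)] with y hy
      rw [hy, Pi.add_apply, add_mul]
    have h2 : ∀ᵐ x ∂(volume.restrict Γ),
        (g + h) x i * φ x = g x i * φ x + h x i * φ x := by
      filter_upwards [Lp.coeFn_add g h] with x hx
      rw [hx]
      simp [add_mul]
    simp only [Prod.mk_add_mk]
    rw [integral_congr_ae h1, integral_congr_ae h2,
      integral_add (integrable_mul_fderiv Γ u hφ hc _).restrict
        (integrable_mul_fderiv Γ v hφ hc _).restrict,
      integral_add (integrable_coord_mul Γ g hφ hc i) (integrable_coord_mul Γ h hφ hc i),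
      hu φ hφ hc hs i, hv φ hφ hc hs i]
    ring
  smul_mem' := by
    rintro c ⟨u, g⟩ hu φ hφ hc hs i
    have h1 : ∀ᵐ y ∂((closureMeasure Γ).restrict
        {y : closure Γ | (y : EuclideanSpace ℝ (Fin d)) ∈ Γ}),
        (c • u) y * fderiv ℝ φ y (EuclideanSpace.single i 1)
          = c * (u y * fderiv ℝ φ y (EuclideanSpace.single i 1)) := by
      filter_upwards [ae_restrict_of_ae (Lp.coeFn_smul c u)] with y hy
      rw [hy]
      simp [mul_assoc]
    have h2 : ∀ᵐ x ∂(volume.restrict Γ), (c • g) x i * φ x = c * (g x i * φ x) := by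
      filter_upwards [Lp.coeFn_smul c g] with x hx
      rw [hx]
      simp [mul_assoc]
    simp only [Prod.smul_mk]
    rw [integral_congr_ae h1, integral_congr_ae h2, integral_const_mul, integral_const_mul,
      hu φ hφ hc hs i]
    ring

/-- Weak gradients on an open set are unique. -/
theorem IsWeakGradient.unique {Γ : Set (EuclideanSpace ℝ (Fin d))} (hΓ : IsOpen Γ)
    {u : Lp ℝ 2 (closureMeasure Γ)}
    {g h : Lp (EuclideanSpace ℝ (Fin d)) 2 (volume.restrict Γ)}
    (hg : IsWeakGradient Γ u g) (hh : IsWeakGradient Γ u h) : g = h := by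
  have key : ∀ i : Fin d, ∀ᵐ x ∂(volume.restrict Γ), g x i - h x i = 0 := by
    intro i
    rw [ae_restrict_iff' hΓ.measurableSet]
    refine hΓ.ae_eq_zero_of_integral_contDiff_smul_eq_zero ?_ ?_
    · have h2 : MemLp (fun x => g x i - h x i) 2 (volume.restrict Γ) :=
        ((EuclideanSpace.proj (𝕜 := ℝ) i).comp_memLp' (Lp.memLp g)).sub
          ((EuclideanSpace.proj (𝕜 := ℝ) i).comp_memLp' (Lp.memLp h))
      exact locallyIntegrableOn_of_locallyIntegrable_restrict
        (h2.locallyIntegrable (by norm_num))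
    · intro φ hφ hc hs
      have h0 : ∫ x in Γ, (g x i * φ x - h x i * φ x) = 0 := by
        rw [integral_sub (integrable_coord_mul Γ g hφ hc i) (integrable_coord_mul Γ h hφ hc i)]
        have e1 := hg φ hφ hc hs i
        have e2 := hh φ hφ hc hs i
        linarith
      rw [← setIntegral_eq_integral_of_forall_compl_eq_zero (s := Γ), ← h0]
      · congr 1
        ext x
        simp only [smul_eq_mul]
        ring
      · intro x hx
        rw [image_eq_zero_of_notMem_tsupport fun hx' => hx (hs hx'), zero_smul]
  apply Lp.ext
  filter_upwards [ae_all_iff.2 key] with x hx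
  ext i
  linarith [hx i]

/-- The weak gradient as a linear operator from `L²(closure Γ)` to `L²(Γ; ℝᵈ)`, whose domain is
`H¹(Γ)`, the space of all `u` that have a square integrable weak gradient on `Γ`. -/
def weakGradient (Γ : Set (EuclideanSpace ℝ (Fin d))) :
    Lp ℝ 2 (closureMeasure Γ) →ₗ.[ℝ]
      Lp (EuclideanSpace ℝ (Fin d)) 2 (volume.restrict Γ) :=
  (weakGradientGraph Γ).toLinearPMap

/-- `H¹(Γ)` consists of the functions having a weak gradient in `L²`, and `weakGradient` gives it. -/
theorem weakGradient_spec {Γ : Set (EuclideanSpace ℝ (Fin d))} (hΓ : IsOpen Γ) :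
    (∀ u, u ∈ (weakGradient Γ).domain ↔ ∃ g, IsWeakGradient Γ u g) ∧
      ∀ u : (weakGradient Γ).domain, IsWeakGradient Γ u (weakGradient Γ u) := by
  have H : ∀ p ∈ weakGradientGraph Γ, p.1 = 0 → p.2 = 0 := by
    rintro ⟨u, g⟩ hp rfl
    exact IsWeakGradient.unique hΓ hp (weakGradientGraph Γ).zero_mem
  refine ⟨fun u => ?_, fun u => Submodule.mem_graph_toLinearPMap H u⟩
  simp only [weakGradient, Submodule.toLinearPMap_domain, Submodule.mem_map]
  exact ⟨fun ⟨p, hp, hpu⟩ => ⟨p.2, hpu ▸ hp⟩, fun ⟨g, hg⟩ => ⟨(u, g), hg, rfl⟩⟩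

/-- The form `(½ D_Γ, H¹(Γ))` on `L²(closure Γ)`, where `D_Γ(u, v) = ∫_Γ ∇u · ∇v dx`. -/
def reflectingForm (Γ : Set (EuclideanSpace ℝ (Fin d))) :
    L2Form (closureMeasure Γ) where
  domain := (weakGradient Γ).domain
  form := LinearMap.mk₂ ℝ
    (fun u v => (1 / 2) * ∫ x in Γ, inner ℝ (weakGradient Γ u x) (weakGradient Γ v x))
    (fun u u' v => by
      simp only [← L2.inner_def, LinearPMap.map_add, inner_add_left, mul_add])
    (fun c u v => by
      simp only [← L2.inner_def, LinearPMap.map_smul, real_inner_smul_left, smul_eq_mul]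
      ring)
    (fun u v v' => by
      simp only [← L2.inner_def, LinearPMap.map_add, inner_add_right, mul_add])
    (fun c u v => by
      simp only [← L2.inner_def, LinearPMap.map_smul, real_inner_smul_right, smul_eq_mul]
      ring)

end Reflecting

/-- `Γ ⊆ ℝⁿ⁺¹` has continuous boundary: every boundary point has a neighbourhood `U` on which, in
some Cartesian coordinate system `e`, `Γ` is the set above the graph of a continuous function. -/
def HasContinuousBoundary {n : ℕ} (Γ : Set (EuclideanSpace ℝ (Fin (n + 1)))) : Prop :=
  ∀ x ∈ frontier Γ, ∃ U ∈ 𝓝 x,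
    ∃ e : EuclideanSpace ℝ (Fin (n + 1)) ≃ᵃⁱ[ℝ] EuclideanSpace ℝ (Fin (n + 1)),
    ∃ F : (Fin n → ℝ) → ℝ, Continuous F ∧
      Γ ∩ U = {y | F (fun i => e y i.castSucc) < e y (Fin.last n)} ∩ U

end

/-! Take a compact `K ⊆ ℝ` without interior points such that the slab `x_j ∈ K` meets `Γ` in
positive measure. Let `S = collapse K j` replace `x_j` by `x_j` minus the signed length of `K`
between `0` and `x_j`. Every interval meets the complement of `K` in positive measure, so `S` is a
homeomorphism. Its weak derivative annihilates `e_j` over `K`.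

The smaller domain ℱ' consists of the H¹-limits of the functions `f ∘ S` with `f` smooth and
compactly supported. Every element of ℱ' has vanishing `j`-th derivative a.e. on the slab, whereas a
cut-off version of `x ↦ x_j` does not; hence ℱ' is proper
(`exists_mem_collapsedGraph_empty_notMem_closure`). It is still regular
(`L2Form.isRegularDirichletForm_of_mem_domain_iff`), since composition with a homeomorphism
preserves uniform density in the compactly supported continuous functions. Forms are handled through
closed subspaces of pairs `(u, ∇u)`: the weak gradient is a closed operator with unique values, so
the closure of the smooth pairs is again a graph.

The full form must be shown regular too. The same lemma applies with `K = ∅`, `S = id`, once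
restrictions of smooth functions are known to be dense in H¹(Γ) (`weakGradientGraph_le_closure`).
This is where the continuous boundary enters. After a cutoff and a partition of unity, one mollifies
with a bump centred at a small shift, so that values at points of `Γ` only involve points further
inside `Γ`. There, mollification commutes with the weak gradient.

Both the Markov property and the density argument produce functions converging in L² whose gradients
are merely bounded. `Submodule.exists_mem_of_tendsto_fst_of_norm_snd_le` turns this into membership
of the limit in the closed subspace. -/

/-! ### Limits with bounded second component -/

/-- A closed subspace of a product whose second factor is a Hilbert space is stable under limits of
the first component along which the second component stays bounded. -/
theorem Submodule.exists_mem_of_tendsto_fst_of_norm_snd_le {G H : Type*} [NormedAddCommGroup G]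
    [NormedSpace ℝ G] [NormedAddCommGroup H] [InnerProductSpace ℝ H] [CompleteSpace H]
    {W : Submodule ℝ (G × H)} (hW : IsClosed (W : Set (G × H))) {v : ℕ → G} {g : ℕ → H} {a : G}
    {c : ℝ} (h : ∀ k, (v k, g k) ∈ W) (hv : Tendsto v atTop (𝓝 a)) (hg : ∀ k, ‖g k‖ ≤ c) :
    ∃ b, (a, b) ∈ W ∧ ‖b‖ ≤ c := by
  -- The sets `A k` are nested, bounded, nonempty and midpoint-convex. Nearly norm-minimal elements
  -- of them form a Cauchy sequence, which replaces weak compactness.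
  set A : ℕ → Set H := fun k => {b | ‖b‖ ≤ c ∧ ∃ w, ‖w - a‖ ≤ 1 / (k + 1 : ℝ) ∧ (w, b) ∈ W} with hA
  have hne : ∀ k, (A k).Nonempty := by
    intro k
    obtain ⟨N, hN⟩ := Metric.tendsto_atTop.1 hv (1 / (k + 1 : ℝ)) (by positivity)
    exact ⟨g N, hg N, v N, by simpa [dist_eq_norm] using (hN N le_rfl).le, h N⟩
  have hanti : ∀ {k l}, k ≤ l → A l ⊆ A k := by
    rintro k l hkl b ⟨hb, w, hw, hwb⟩
    refine ⟨hb, w, hw.trans ?_, hwb⟩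
    gcongr
  have hmid : ∀ k, ∀ b ∈ A k, ∀ b' ∈ A k, (1 / 2 : ℝ) • (b + b') ∈ A k := by
    rintro k b ⟨hb, w, hw, hwb⟩ b' ⟨hb', w', hw', hwb'⟩
    refine ⟨?_, (1 / 2 : ℝ) • (w + w'), ?_, ?_⟩
    · rw [norm_smul, Real.norm_of_nonneg (by norm_num)]
      linarith [norm_add_le b b']
    · have : (1 / 2 : ℝ) • (w + w') - a = (1 / 2 : ℝ) • ((w - a) + (w' - a)) := by module
      rw [this, norm_smul, Real.norm_of_nonneg (by norm_num)]
      linarith [norm_add_le (w - a) (w' - a)]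
    · exact W.smul_mem _ (W.add_mem hwb hwb')
  set r : ℕ → ℝ := fun k => Metric.infDist 0 (A k) with hr
  have hr_le : ∀ k, ∀ b ∈ A k, r k ≤ ‖b‖ := fun k b hb => by
    simpa using Metric.infDist_le_dist_of_mem (x := (0 : H)) hb
  have hr0 : ∀ k, 0 ≤ r k := fun k => Metric.infDist_nonneg
  have hrc : ∀ k, r k ≤ c := fun k => by
    obtain ⟨b, hb⟩ := hne k
    exact (hr_le k b hb).trans hb.1
  have hrm : Monotone r := fun k l hkl =>
    Metric.infDist_le_infDist_of_subset (hanti hkl) (hne l)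
  have hex : ∀ k : ℕ, ∃ b ∈ A k, ‖b‖ < r k + 1 / (k + 1 : ℝ) := fun k => by
    have hlt : Metric.infDist 0 (A k) < r k + 1 / (k + 1 : ℝ) :=
      lt_add_of_pos_right _ (by positivity)
    obtain ⟨b, hb, hb'⟩ := (Metric.infDist_lt_iff (hne k)).1 hlt
    exact ⟨b, hb, by simpa using hb'⟩
  choose b hbA hbr using hex
  obtain ⟨R, hR⟩ : ∃ R, Tendsto r atTop (𝓝 R) :=
    ⟨_, tendsto_atTop_ciSup hrm ⟨c, by rintro _ ⟨k, rfl⟩; exact hrc k⟩⟩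
  have hinv : Tendsto (fun k : ℕ => 1 / (k + 1 : ℝ)) atTop (𝓝 0) :=
    tendsto_one_div_add_atTop_nhds_zero_nat
  have hbR : Tendsto (fun k => ‖b k‖) atTop (𝓝 R) :=
    tendsto_of_tendsto_of_tendsto_of_le_of_le hR (by simpa using hR.add hinv)
      (fun k => hr_le k _ (hbA k)) (fun k => (hbr k).le)
  have hcau : CauchySeq b := by
    rw [Metric.cauchySeq_iff']
    intro ε hε
    have hlim : Tendsto (fun p : ℕ × ℕ => 2 * ‖b p.1‖ ^ 2 + 2 * ‖b p.2‖ ^ 2 - 4 * (r p.2) ^ 2)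
        (atTop ×ˢ atTop) (𝓝 (2 * R ^ 2 + 2 * R ^ 2 - 4 * R ^ 2)) :=
      ((((hbR.comp tendsto_fst).pow 2).const_mul 2).add
        (((hbR.comp tendsto_snd).pow 2).const_mul 2)).sub
        (((hR.comp tendsto_snd).pow 2).const_mul 4)
    have hlt : 2 * R ^ 2 + 2 * R ^ 2 - 4 * R ^ 2 < ε ^ 2 := by
      have : 0 < ε ^ 2 := by positivity
      linarith
    have hev := hlim.eventually_lt_const hlt
    rw [prod_atTop_atTop_eq] at hev
    -- For `k ≥ N` the midpoint of `b k` and `b N` lies in `A N`, so its norm is at least `r N`. The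
    -- parallelogram law then bounds the distance.
    obtain ⟨⟨N₁, N₂⟩, hN⟩ := eventually_atTop.1 hev
    refine ⟨max N₁ N₂, fun k hk => ?_⟩
    have h1 := hN (k, max N₁ N₂) ⟨(le_max_left _ _).trans hk, le_max_right _ _⟩
    have h2 := hr_le _ _ (hmid _ _ (hanti hk (hbA k)) _ (hbA (max N₁ N₂)))
    rw [norm_smul, Real.norm_of_nonneg (by norm_num)] at h2
    have h3 := parallelogram_law_with_norm ℝ (b k) (b (max N₁ N₂))
    have h4 := hr0 (max N₁ N₂)
    rw [dist_eq_norm]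
    refine lt_of_pow_lt_pow_left₀ 2 hε.le ?_
    simp only at h1
    nlinarith
  obtain ⟨B, hB⟩ := cauchySeq_tendsto_of_complete hcau
  choose hbc w hw hwW using hbA
  have hwa : Tendsto w atTop (𝓝 a) := by
    rw [tendsto_iff_norm_sub_tendsto_zero]
    exact squeeze_zero (fun k => norm_nonneg _) hw hinv
  exact ⟨B, hW.mem_of_tendsto (hwa.prodMk_nhds hB) (Eventually.of_forall hwW),
    le_of_tendsto hB.norm (Eventually.of_forall hbc)⟩

/-! ### Mollification and smooth approximation -/

section Mollification

variable {E : Type*} [NormedAddCommGroup E] [MeasurableSpace E] [BorelSpace E]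
  [SecondCountableTopology E] {μ : Measure E} [SFinite μ] [μ.IsAddRightInvariant]

/-- Convolution with a probability density is a contraction on `L²`. -/
theorem MeasureTheory.eLpNorm_convolution_le {ρ V : E → ℝ} (hρ : Continuous ρ) (hρ0 : ∀ x, 0 ≤ ρ x)
    (hρ1 : ∫⁻ x, ENNReal.ofReal (ρ x) ∂μ = 1) (hV : Measurable V) :
    eLpNorm (convolution ρ V (ContinuousLinearMap.lsmul ℝ ℝ) μ) 2 μ ≤ eLpNorm V 2 μ := by
  have hm : Measurable fun x => ENNReal.ofReal (ρ x) := hρ.measurable.ennreal_ofReal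
  set ν : Measure E := μ.withDensity fun x => ENNReal.ofReal (ρ x) with hν
  have : IsProbabilityMeasure ν := ⟨by rw [hν, withDensity_apply _ .univ]; simpa using hρ1⟩
  -- Jensen's inequality for the probability measure `ν = ρ μ`. Tonelli and translation invariance
  -- then finish the proof.
  have hpt : ∀ x, ‖convolution ρ V (ContinuousLinearMap.lsmul ℝ ℝ) μ x‖ₑ ^ 2
      ≤ ∫⁻ y, ‖V (x - y)‖ₑ ^ 2 ∂ν := by
    intro x
    have hVx : Measurable fun y => V (x - y) := hV.comp (measurable_const.sub measurable_id)
    have h1 : ‖convolution ρ V (ContinuousLinearMap.lsmul ℝ ℝ) μ x‖ₑ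
        ≤ eLpNorm (fun y => V (x - y)) 1 ν := by
      rw [eLpNorm_one_eq_lintegral_enorm, hν, lintegral_withDensity_eq_lintegral_mul _ hm hVx.enorm]
      refine (enorm_integral_le_lintegral_enorm _).trans (lintegral_mono fun y => ?_)
      simp [enorm_mul, Real.enorm_of_nonneg (hρ0 y)]
    have h2 := h1.trans (eLpNorm_le_eLpNorm_of_exponent_le (p := 1) (q := 2) (by norm_num)
      hVx.aestronglyMeasurable)
    calc _ ≤ (eLpNorm (fun y => V (x - y)) 2 ν) ^ 2 := by gcongr
      _ = _ := by
        rw [eLpNorm_eq_lintegral_rpow_enorm_toReal (by norm_num) (by norm_num),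
          ← ENNReal.rpow_natCast, ← ENNReal.rpow_mul]
        norm_num
  rw [eLpNorm_eq_lintegral_rpow_enorm_toReal (by norm_num) (by norm_num),
    eLpNorm_eq_lintegral_rpow_enorm_toReal (by norm_num) (by norm_num)]
  gcongr ?_ ^ _
  simp only [ENNReal.toReal_ofNat, ENNReal.rpow_ofNat]
  calc _ ≤ ∫⁻ x, ∫⁻ y, ‖V (x - y)‖ₑ ^ 2 ∂ν ∂μ := lintegral_mono hpt
    _ = ∫⁻ y, ∫⁻ x, ‖V (x - y)‖ₑ ^ 2 ∂μ ∂ν := by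
      refine lintegral_lintegral_swap ?_
      exact ((hV.comp (measurable_fst.sub measurable_snd)).enorm.pow_const 2).aemeasurable
    _ = ∫⁻ y, ∫⁻ x, ‖V x‖ₑ ^ 2 ∂μ ∂ν := by
      refine lintegral_congr fun y => ?_
      exact lintegral_sub_right_eq_self (fun x => ‖V x‖ₑ ^ 2) y
    _ = _ := by simp

end Mollification

section SmoothApproximation

variable {E : Type*} [NormedAddCommGroup E] [NormedSpace ℝ E] [FiniteDimensional ℝ E]

/-- A compactly supported continuous function is a uniform limit of smooth functions supported in
a fixed compact set. -/
theorem HasCompactSupport.exists_contDiff_abs_sub_lt {h : E → ℝ} (hc : HasCompactSupport h)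
    (hh : Continuous h) {ε : ℝ} (hε : 0 < ε) :
    ∃ f : E → ℝ, ContDiff ℝ ∞ f ∧ HasCompactSupport f ∧
      (∀ x ∉ Metric.cthickening 1 (tsupport h), f x = 0) ∧ ∀ x, |h x - f x| < ε := by
  obtain ⟨δ, hδ, hδh⟩ := Metric.uniformContinuous_iff.1 (hc.uniformContinuous_of_continuous hh)
    (ε / 2) (half_pos hε)
  obtain ⟨f, hf, hfd⟩ := hh.exists_contDiff_dist_le_of_forall_mem_ball_dist_le
    (lt_min one_pos hδ)
  -- The smoothing radius is at most `1`, so off this neighbourhood `f x` only sees zeros of `h`;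
  -- the averaging estimate with error `0` gives `f x = 0`.
  have h0 : ∀ x ∉ Metric.cthickening 1 (tsupport h), f x = 0 := by
    intro x hx
    have hz : ∀ y ∈ Metric.closedBall x 1, h y = 0 := by
      intro y hy
      by_contra hy0
      exact hx (Metric.mem_cthickening_of_dist_le x y 1 _ (subset_tsupport h hy0)
        (by rwa [dist_comm]))
    have hx0 := hz x (Metric.mem_closedBall_self zero_le_one)
    have := hfd x 0 fun y hy => by
      rw [hx0, hz y (Metric.ball_subset_closedBall
        (Metric.ball_subset_ball (min_le_left _ _) hy)), dist_self]
    rw [hx0] at this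
    exact dist_le_zero.1 this
  refine ⟨f, hf, HasCompactSupport.intro (hc.isCompact.cthickening) h0, h0, fun x => ?_⟩
  have := hfd x (ε / 2) fun y hy =>
    (hδh (Metric.ball_subset_ball (min_le_right _ _) hy)).le
  rw [Real.dist_eq, abs_sub_comm] at this
  linarith

end SmoothApproximation

section Mollification

variable {E : Type*} [NormedAddCommGroup E] [NormedSpace ℝ E] [FiniteDimensional ℝ E]
  [MeasurableSpace E] [BorelSpace E] {μ : Measure E} [μ.IsAddHaarMeasure]

theorem ContDiffBump.eLpNorm_normed_convolution_le {b : E} (φ : ContDiffBump b) {V : E → ℝ}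
    (hV : Measurable V) :
    eLpNorm (convolution (φ.normed μ) V (ContinuousLinearMap.lsmul ℝ ℝ) μ) 2 μ
      ≤ eLpNorm V 2 μ := by
  refine eLpNorm_convolution_le φ.continuous_normed φ.nonneg_normed ?_ hV
  rw [← ofReal_integral_eq_lintegral_ofReal φ.integrable_normed
    (Eventually.of_forall φ.nonneg_normed), φ.integral_normed, ENNReal.ofReal_one]

/-- Mollification by bump functions concentrating at the origin, not necessarily centred there,
converges in `L²`: the case of continuous functions with compact support. -/
theorem HasCompactSupport.exists_forall_eLpNorm_normed_convolution_sub_le {h : E → ℝ}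
    (hc : HasCompactSupport h) (hh : Continuous h) {ε : ENNReal} (hε : ε ≠ 0) :
    ∃ δ > 0, ∀ (b : E) (φ : ContDiffBump b), ‖b‖ + φ.rOut < δ →
      eLpNorm (convolution (φ.normed μ) h (ContinuousLinearMap.lsmul ℝ ℝ) μ - h) 2 μ ≤ ε := by
  set k := Metric.cthickening 1 (tsupport h) with hk
  have hkc : IsCompact k := hc.isCompact.cthickening
  obtain ⟨η, hη, hηε⟩ : ∃ η : ℝ, 0 < η ∧
      ENNReal.ofReal η * (μ k) ^ (1 / (2 : ENNReal).toReal) ≤ ε := by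
    have hfin : (μ k) ^ (1 / (2 : ENNReal).toReal) ≠ ⊤ :=
      ENNReal.rpow_ne_top_of_nonneg (by positivity) hkc.measure_lt_top.ne
    have hlim : Tendsto (fun η : ℝ => ENNReal.ofReal η * (μ k) ^ (1 / (2 : ENNReal).toReal))
        (𝓝[>] 0) (𝓝 0) := by
      have h1 : Tendsto (fun η : ℝ => ENNReal.ofReal η) (𝓝[>] 0) (𝓝 0) := by
        have := (ENNReal.continuous_ofReal.tendsto (0 : ℝ)).mono_left
          (nhdsWithin_le_nhds (s := Set.Ioi 0))
        simpa using this
      simpa using ENNReal.Tendsto.mul_const h1 (Or.inr hfin)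
    obtain ⟨η, h1, h2⟩ := ((hlim.eventually_le_const (pos_iff_ne_zero.2 hε)).and
      self_mem_nhdsWithin).exists
    exact ⟨η, h2, h1⟩
  obtain ⟨δ, hδ, hδh⟩ := Metric.uniformContinuous_iff.1
    (hc.uniformContinuous_of_continuous hh) η hη
  refine ⟨min δ 1, by positivity, fun b φ hb => ?_⟩
  set R := ‖b‖ + φ.rOut with hR
  -- The bump centred at `b` is also supported in a ball about the origin, so the usual
  -- approximate-identity estimate applies with radius `R`.
  have hsupp : Function.support (φ.normed μ) ⊆ Metric.ball 0 R := by
    rw [φ.support_normed_eq]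
    refine Metric.ball_subset_ball' ?_
    rw [dist_zero_right, hR, add_comm]
  have key : ∀ x η', 0 ≤ η' → (∀ y ∈ Metric.ball x R, dist (h y) (h x) ≤ η') →
      dist (convolution (φ.normed μ) h (ContinuousLinearMap.lsmul ℝ ℝ) μ x) (h x) ≤ η' :=
    fun x η' hη' hx => dist_convolution_le hη' hsupp φ.nonneg_normed φ.integral_normed
      hh.aestronglyMeasurable hx
  have hz : ∀ x ∉ k,
      (convolution (φ.normed μ) h (ContinuousLinearMap.lsmul ℝ ℝ) μ - h) x = 0 := by
    intro x hx
    have hz : ∀ y ∈ Metric.closedBall x 1, h y = 0 := by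
      intro y hy
      by_contra hy0
      exact hx (Metric.mem_cthickening_of_dist_le x y 1 _ (subset_tsupport h hy0)
        (by rwa [dist_comm]))
    have hx0 := hz x (Metric.mem_closedBall_self zero_le_one)
    have := key x 0 le_rfl fun y hy => by
      rw [hx0, hz y (Metric.ball_subset_closedBall
        (Metric.ball_subset_ball (hb.le.trans (min_le_right _ _)) hy)), dist_self]
    exact sub_eq_zero.2 (dist_le_zero.1 this)
  have hle : ∀ x, ‖(convolution (φ.normed μ) h (ContinuousLinearMap.lsmul ℝ ℝ) μ - h) x‖
      ≤ ‖k.indicator (fun _ => η) x‖ := by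
    intro x
    by_cases hx : x ∈ k
    · rw [Set.indicator_of_mem hx, Real.norm_of_nonneg hη.le, Pi.sub_apply, ← dist_eq_norm]
      exact key x η hη.le fun y hy =>
        (hδh (Metric.ball_subset_ball (hb.le.trans (min_le_left _ _)) hy)).le
    · rw [hz x hx, norm_zero]
      positivity
  refine (eLpNorm_mono hle).trans ?_
  rw [eLpNorm_indicator_const hkc.measurableSet (by norm_num) (by norm_num),
    Real.enorm_of_nonneg hη.le]
  exact hηε

/-- Mollification by bump functions concentrating at the origin, not necessarily centred there,
converges in `L²`. -/
theorem MeasureTheory.MemLp.exists_forall_eLpNorm_normed_convolution_sub_le {V : E → ℝ}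
    (hV : MemLp V 2 μ) (hVm : Measurable V) {ε : ENNReal} (hε : ε ≠ 0) :
    ∃ δ > 0, ∀ (b : E) (φ : ContDiffBump b), ‖b‖ + φ.rOut < δ →
      eLpNorm (convolution (φ.normed μ) V (ContinuousLinearMap.lsmul ℝ ℝ) μ - V) 2 μ ≤ ε := by
  have hε3 : ε / 3 ≠ 0 := by simp [ENNReal.div_eq_zero_iff, hε]
  -- The error `V - h` is paid twice, once directly and once after mollification, where the
  -- contraction property controls it; the last third is for `h` itself.
  obtain ⟨h, hc, hVh, hh, hhL⟩ := hV.exists_hasCompactSupport_eLpNorm_sub_le (by norm_num) hε3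
  obtain ⟨δ, hδ, H⟩ :=
    hc.exists_forall_eLpNorm_normed_convolution_sub_le (μ := μ) hh hε3
  refine ⟨δ, hδ, fun b φ hb => ?_⟩
  set L := ContinuousLinearMap.lsmul ℝ ℝ (E := ℝ)
  have hloc : LocallyIntegrable h μ := hhL.locallyIntegrable (by norm_num)
  have hloc' : LocallyIntegrable (V - h) μ := (hV.sub hhL).locallyIntegrable (by norm_num)
  have e1 : convolution (φ.normed μ) V L μ
      = convolution (φ.normed μ) h L μ + convolution (φ.normed μ) (V - h) L μ := by
    rw [← ConvolutionExists.distrib_add]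
    · simp
    · exact φ.hasCompactSupport_normed.convolutionExists_left _ φ.continuous_normed hloc
    · exact φ.hasCompactSupport_normed.convolutionExists_left _ φ.continuous_normed hloc'
  have e2 : convolution (φ.normed μ) V L μ - V = (convolution (φ.normed μ) h L μ - h)
      + convolution (φ.normed μ) (V - h) L μ - (V - h) := by
    rw [e1]
    abel
  have m1 : AEStronglyMeasurable (convolution (φ.normed μ) h L μ) μ :=
    (φ.hasCompactSupport_normed.continuous_convolution_left _ φ.continuous_normed
      hloc).aestronglyMeasurable
  have m2 : AEStronglyMeasurable (convolution (φ.normed μ) (V - h) L μ) μ :=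
    (φ.hasCompactSupport_normed.continuous_convolution_left _ φ.continuous_normed
      hloc').aestronglyMeasurable
  rw [e2]
  calc _ ≤ eLpNorm ((convolution (φ.normed μ) h L μ - h)
        + convolution (φ.normed μ) (V - h) L μ) 2 μ + eLpNorm (V - h) 2 μ :=
        eLpNorm_sub_le ((m1.sub hh.aestronglyMeasurable).add m2) (hV.sub hhL).1 (by norm_num)
    _ ≤ ε / 3 + ε / 3 + ε / 3 := by
        refine add_le_add ((eLpNorm_add_le (m1.sub hh.aestronglyMeasurable) m2
          (by norm_num)).trans (add_le_add (H b φ hb) ?_)) hVh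
        exact (φ.eLpNorm_normed_convolution_le (hVm.sub hh.measurable)).trans hVh
    _ = ε := ENNReal.add_thirds ε

end Mollification

/-- The unit contraction is a uniform limit of smooth contractions fixing the origin. -/
theorem exists_contDiff_abs_deriv_le_one_abs_sub_unitContraction_le {ε : ℝ} (hε : 0 < ε) :
    ∃ φ : ℝ → ℝ, ContDiff ℝ ∞ φ ∧ φ 0 = 0 ∧ (∀ t, |deriv φ t| ≤ 1) ∧
      ∀ t, |φ t - min (max t 0) 1| ≤ ε := by
  set c : ℝ → ℝ := fun t => min (max t 0) 1 with hc
  have hcl : ∀ s t, |c s - c t| ≤ |s - t| := by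
    intro s t
    simp only [hc]
    rcases le_total s 0 with h1 | h1 <;> rcases le_total t 0 with h2 | h2 <;>
    rcases le_total s 1 with h3 | h3 <;> rcases le_total t 1 with h4 | h4 <;>
    simp only [max_eq_left, max_eq_right, min_eq_left, min_eq_right, zero_le_one, *] <;>
    rw [abs_le] <;> constructor <;> (rcases abs_cases (s - t) with h | h <;> linarith)
  have hcc : Continuous c := by fun_prop
  -- Radius `ε / 2` keeps the mollified contraction within `ε / 2`; subtracting its value at `0`, to
  -- fix the origin, costs at most another `ε / 2`.
  set ρ : ContDiffBump (0 : ℝ) := ⟨ε / 4, ε / 2, by positivity, by linarith⟩ with hρ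
  set L := ContinuousLinearMap.lsmul ℝ ℝ (E := ℝ)
  set ψ := convolution (ρ.normed volume) c L volume with hψ
  have hloc : LocallyIntegrable c volume := hcc.locallyIntegrable
  have hψs : ContDiff ℝ ∞ ψ :=
    ρ.hasCompactSupport_normed.contDiff_convolution_left _ ρ.contDiff_normed hloc
  have hint : ∀ t, Integrable (fun y => ρ.normed volume y * c (t - y)) := fun t =>
    (ρ.hasCompactSupport_normed.convolutionExists_left L ρ.continuous_normed hloc t)
  have hlip : LipschitzWith 1 ψ := by
    refine LipschitzWith.of_dist_le_mul fun s t => ?_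
    simp only [NNReal.coe_one, one_mul, Real.dist_eq, hψ, convolution_def, L,
      ContinuousLinearMap.lsmul_apply, smul_eq_mul]
    rw [← integral_sub (hint s) (hint t)]
    calc _ ≤ ∫ y, |ρ.normed volume y * c (s - y) - ρ.normed volume y * c (t - y)| :=
          abs_integral_le_integral_abs
      _ ≤ ∫ y, ρ.normed volume y * |s - t| := by
          refine integral_mono ((hint s).sub (hint t)).abs (ρ.integrable_normed.mul_const _)
            fun y => ?_
          simp only
          rw [← mul_sub, abs_mul, abs_of_nonneg (ρ.nonneg_normed y)]
          refine mul_le_mul_of_nonneg_left ((hcl _ _).trans_eq ?_) (ρ.nonneg_normed y)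
          congr 1
          ring
      _ = |s - t| := by rw [integral_mul_const, ρ.integral_normed, one_mul]
  have hclose : ∀ t, |ψ t - c t| ≤ ε / 2 := fun t => by
    rw [← Real.dist_eq]
    refine ρ.dist_normed_convolution_le hcc.aestronglyMeasurable fun y hy => ?_
    rw [Real.dist_eq]
    exact (hcl _ _).trans (by simpa [Real.dist_eq] using (Metric.mem_ball.1 hy).le)
  refine ⟨fun t => ψ t - ψ 0, hψs.sub contDiff_const, sub_self _, fun t => ?_, fun t => ?_⟩
  · rw [deriv_sub_const]
    simpa using norm_deriv_le_of_lipschitz hlip (x₀ := t)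
  · have h0 := hclose 0
    have h1 := hclose t
    have hc0 : c 0 = 0 := by simp [hc]
    rw [hc0] at h0
    rw [abs_le] at *
    change -ε ≤ ψ t - ψ 0 - c t ∧ ψ t - ψ 0 - c t ≤ ε
    constructor <;> linarith

/-! ### The collapsing homeomorphism and its weak derivative -/

noncomputable section

section Collapse

variable {d : ℕ} {K : Set ℝ}

/-- The signed length of the part of `K` that lies between `0` and `t`. -/
def occupation (K : Set ℝ) (t : ℝ) : ℝ := ∫ τ in (0 : ℝ)..t, K.indicator 1 τ

theorem intervalIntegrable_indicator_one (hK : MeasurableSet K) (s t : ℝ) :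
    IntervalIntegrable (K.indicator (1 : ℝ → ℝ)) volume s t := by
  have h : IntervalIntegrable (fun _ : ℝ => (1 : ℝ)) volume s t := intervalIntegrable_const
  rw [intervalIntegrable_iff] at h ⊢
  exact h.indicator hK

theorem occupation_sub (hK : MeasurableSet K) (s t : ℝ) :
    occupation K t - occupation K s = ∫ τ in s..t, K.indicator 1 τ :=
  intervalIntegral.integral_interval_sub_left (intervalIntegrable_indicator_one hK _ _)
    (intervalIntegrable_indicator_one hK _ _)

theorem continuous_occupation (hK : MeasurableSet K) : Continuous (occupation K) :=
  intervalIntegral.continuous_primitive (intervalIntegrable_indicator_one hK) 0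

@[simp]
theorem occupation_empty : occupation ∅ = 0 := by
  ext t
  simp [occupation]

theorem abs_occupation_le (hK : MeasurableSet K) (hfin : volume K ≠ ⊤) (t : ℝ) :
    |occupation K t| ≤ volume.real K := by
  have h : ∀ s t : ℝ, s ≤ t → |∫ τ in s..t, K.indicator (1 : ℝ → ℝ) τ| ≤ volume.real K := by
    intro s t hst
    rw [intervalIntegral.integral_of_le hst, integral_indicator_one hK, abs_of_nonneg (by positivity),
      measureReal_restrict_apply hK]
    exact measureReal_mono Set.inter_subset_left hfin
  rcases le_total 0 t with ht | ht
  · exact h 0 t ht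
  · rw [occupation, intervalIntegral.integral_symm, abs_neg]
    exact h t 0 ht

/-- The increment over `(s, t]` is the length of the part of that interval outside `K`. Since `K` is
closed without interior points, this part contains a nonempty open set. -/
theorem strictMono_sub_occupation (hK : IsClosed K) (hKi : interior K = ∅) :
    StrictMono fun t => t - occupation K t := by
  intro s t hst
  have h1 := occupation_sub hK.measurableSet s t
  rw [intervalIntegral.integral_of_le hst.le, integral_indicator_one hK.measurableSet,
    measureReal_restrict_apply hK.measurableSet] at h1
  have h2 : volume.real (K ∩ Set.Ioc s t) + volume.real (Set.Ioc s t \ K)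
      = volume.real (Set.Ioc s t) := by
    rw [Set.inter_comm]
    exact measureReal_inter_add_sdiff hK.measurableSet measure_Ioc_lt_top.ne
  have h3 : 0 < volume.real (Set.Ioc s t \ K) := by
    have hne : (Set.Ioo s t \ K).Nonempty := by
      by_contra hne
      rw [Set.not_nonempty_iff_eq_empty, Set.sdiff_eq_empty] at hne
      have := interior_maximal hne isOpen_Ioo
      rw [hKi] at this
      obtain ⟨x, hx⟩ := Set.nonempty_Ioo.2 hst
      exact this hx
    have hpos := (isOpen_Ioo.sdiff hK).measure_pos (volume : Measure ℝ) hne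
    refine ENNReal.toReal_pos (hpos.trans_le (measure_mono ?_)).ne' ?_
    · exact Set.sdiff_subset_sdiff_left Set.Ioo_subset_Ioc_self
    · exact ne_top_of_le_ne_top measure_Ioc_lt_top.ne (measure_mono Set.sdiff_subset)
  rw [Real.volume_real_Ioc_of_le hst.le] at h2
  simp only
  linarith

/-- The increasing homeomorphism `t ↦ t - |K ∩ [0, t]|` of the line. -/
def occupationHomeomorph (hK : IsCompact K) (hKi : interior K = ∅) : ℝ ≃ₜ ℝ :=
  ((strictMono_sub_occupation hK.isClosed hKi).orderIsoOfSurjective _ (by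
    -- The map differs from the identity by at most `|K|`, hence tends to `±∞` at both ends.
    have hb := abs_occupation_le hK.measurableSet hK.measure_lt_top.ne
    refine Continuous.surjective
      (continuous_id.sub (continuous_occupation hK.measurableSet)) ?_ ?_
    · refine tendsto_atTop_mono (fun t => ?_)
        (tendsto_atTop_add_const_right atTop (-volume.real K) tendsto_id)
      have := (abs_le.1 (hb t)).2
      simp only [id]
      linarith
    · refine tendsto_atBot_mono (fun t => ?_)
        (tendsto_atBot_add_const_right atBot (volume.real K) tendsto_id)
      have := (abs_le.1 (hb t)).1
      simp only [id]
      linarith)).toHomeomorph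

theorem occupationHomeomorph_apply (hK : IsCompact K) (hKi : interior K = ∅) (t : ℝ) :
    occupationHomeomorph hK hKi t = t - occupation K t := rfl

/-- The map of `ℝᵈ` that collapses the slab over `K` in the direction of the `j`-th coordinate. -/
def collapse (K : Set ℝ) (j : Fin d) (x : EuclideanSpace ℝ (Fin d)) : EuclideanSpace ℝ (Fin d) :=
  x - occupation K (x j) • EuclideanSpace.single j 1

@[simp]
theorem collapse_empty (j : Fin d) : collapse ∅ j = id := by
  ext x
  simp [collapse]

theorem continuous_collapse (hK : MeasurableSet K) (j : Fin d) : Continuous (collapse K j) := by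
  have := continuous_occupation hK
  unfold collapse
  fun_prop

/-- The collapse of a slab over a compact set without interior points is a homeomorphism. -/
def collapseHomeomorph (hK : IsCompact K) (hKi : interior K = ∅) (j : Fin d) :
    EuclideanSpace ℝ (Fin d) ≃ₜ EuclideanSpace ℝ (Fin d) where
  toFun := collapse K j
  invFun y := y + ((occupationHomeomorph hK hKi).symm (y j) - y j) • EuclideanSpace.single j 1
  left_inv x := by
    have h : x j - occupation K (x j) = occupationHomeomorph hK hKi (x j) := rfl
    have h' : collapse K j x j = occupationHomeomorph hK hKi (x j) := by
      rw [← h]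
      simp [collapse]
    simp only [h', Homeomorph.symm_apply_apply]
    rw [← h, collapse]
    module
  right_inv y := by
    have h : (y + ((occupationHomeomorph hK hKi).symm (y j) - y j) •
        (EuclideanSpace.single j 1 : EuclideanSpace ℝ (Fin d))) j
        = (occupationHomeomorph hK hKi).symm (y j) := by simp
    have h' := occupationHomeomorph_apply hK hKi ((occupationHomeomorph hK hKi).symm (y j))
    rw [Homeomorph.apply_symm_apply] at h'
    rw [collapse, h]
    have h'' : occupation K ((occupationHomeomorph hK hKi).symm (y j))
        = (occupationHomeomorph hK hKi).symm (y j) - y j := by linarith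
    rw [h'']
    module
  continuous_toFun := continuous_collapse hK.measurableSet j
  continuous_invFun := by
    have := (occupationHomeomorph hK hKi).symm.continuous
    fun_prop

theorem HasCompactSupport.comp_collapse {f : EuclideanSpace ℝ (Fin d) → ℝ}
    (hf : HasCompactSupport f) (hK : IsCompact K) (hKi : interior K = ∅) (j : Fin d) :
    HasCompactSupport (f ∘ collapse K j) :=
  hf.comp_isClosedEmbedding (collapseHomeomorph hK hKi j).isClosedEmbedding

/-- The derivative of `collapse K j` at `x`, applied to `v`. -/
def collapseDir (K : Set ℝ) (j : Fin d) (x v : EuclideanSpace ℝ (Fin d)) :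
    EuclideanSpace ℝ (Fin d) :=
  v - (K.indicator 1 (x j) * v j) • EuclideanSpace.single j 1

@[simp]
theorem collapseDir_empty (j : Fin d) (x v : EuclideanSpace ℝ (Fin d)) :
    collapseDir ∅ j x v = v := by
  simp [collapseDir]

theorem collapseDir_single_of_mem (j : Fin d) {x : EuclideanSpace ℝ (Fin d)} (hx : x j ∈ K) :
    collapseDir K j x (EuclideanSpace.single j 1) = 0 := by
  simp [collapseDir, hx]

theorem measurable_collapseDir (hK : MeasurableSet K) (j : Fin d) (v : EuclideanSpace ℝ (Fin d)) :
    Measurable fun x => collapseDir K j x v := by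
  have h : Measurable fun x : EuclideanSpace ℝ (Fin d) => K.indicator (1 : ℝ → ℝ) (x j) :=
    (measurable_one.indicator hK).comp (by fun_prop : Continuous fun x :
      EuclideanSpace ℝ (Fin d) => x j).measurable
  unfold collapseDir
  fun_prop

/-- A general `a ∈ [0, 1]` covers both the indicator of `K` and its continuous approximations. The
crude constant `2` is enough for domination. -/
theorem norm_sub_smul_single_le (j : Fin d) (v : EuclideanSpace ℝ (Fin d)) {a : ℝ} (ha : 0 ≤ a)
    (ha1 : a ≤ 1) : ‖v - (a * v j) • (EuclideanSpace.single j 1 : EuclideanSpace ℝ (Fin d))‖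
      ≤ 2 * ‖v‖ := by
  have h1 : ‖v j‖ ≤ ‖v‖ := PiLp.norm_apply_le v j
  have h2 : ‖(a * v j) • (EuclideanSpace.single j 1 : EuclideanSpace ℝ (Fin d))‖ ≤ ‖v‖ := by
    rw [norm_smul, PiLp.norm_single, norm_one, mul_one, norm_mul, Real.norm_of_nonneg ha]
    nlinarith [norm_nonneg (v j)]
  linarith [norm_sub_le v ((a * v j) • (EuclideanSpace.single j 1 : EuclideanSpace ℝ (Fin d)))]

/-- The gradient of `f ∘ collapse K j`. -/
def collapseGradient (K : Set ℝ) (j : Fin d) (f : EuclideanSpace ℝ (Fin d) → ℝ)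
    (x : EuclideanSpace ℝ (Fin d)) : EuclideanSpace ℝ (Fin d) :=
  WithLp.toLp 2 fun i =>
    fderiv ℝ f (collapse K j x) (collapseDir K j x (EuclideanSpace.single i 1))

theorem collapseGradient_apply (j i : Fin d) (f : EuclideanSpace ℝ (Fin d) → ℝ)
    (x : EuclideanSpace ℝ (Fin d)) : collapseGradient K j f x i
      = fderiv ℝ f (collapse K j x) (collapseDir K j x (EuclideanSpace.single i 1)) := rfl

theorem measurable_collapseGradient (hK : MeasurableSet K) (j : Fin d)
    {f : EuclideanSpace ℝ (Fin d) → ℝ} (hf : ContDiff ℝ ∞ f) :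
    Measurable (collapseGradient K j f) := by
  have h1 : Continuous fun x => fderiv ℝ f (collapse K j x) :=
    (hf.continuous_fderiv (by simp)).comp (continuous_collapse hK j)
  refine (WithLp.measurable_toLp 2 _).comp (measurable_pi_lambda _ fun i => ?_)
  exact (isBoundedBilinearMap_apply.continuous.measurable).comp
    (h1.measurable.prodMk (measurable_collapseDir hK j _))

/-- The derivative of `f` composed with the homeomorphism is continuous with compact support, and
the derivative of the collapse is bounded. -/
theorem memLp_collapseGradient (hK : IsCompact K) (hKi : interior K = ∅) (j : Fin d)
    {f : EuclideanSpace ℝ (Fin d) → ℝ} (hf : ContDiff ℝ ∞ f) (hc : HasCompactSupport f) :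
    MemLp (collapseGradient K j f) 2 := by
  have hm := measurable_collapseGradient hK.measurableSet j hf
  have hcs : HasCompactSupport fun x => fderiv ℝ f (collapse K j x) :=
    (hc.fderiv (𝕜 := ℝ)).comp_isClosedEmbedding (collapseHomeomorph hK hKi j).isClosedEmbedding
  have hcont : Continuous fun x => fderiv ℝ f (collapse K j x) :=
    (hf.continuous_fderiv (by simp)).comp (continuous_collapse hK.measurableSet j)
  have hL : MemLp (fun x => fderiv ℝ f (collapse K j x)) 2 volume :=
    hcont.memLp_of_hasCompactSupport hcs
  refine MemLp.of_eval_piLp fun i => ?_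
  refine hL.of_le_mul (c := 2) ?_ (Eventually.of_forall fun x => ?_)
  · exact ((EuclideanSpace.proj (𝕜 := ℝ) i).continuous.measurable.comp hm).aestronglyMeasurable
  · rw [collapseGradient_apply]
    refine (ContinuousLinearMap.le_opNorm _ _).trans ?_
    have h01 : 0 ≤ K.indicator (1 : ℝ → ℝ) (x j) ∧ K.indicator (1 : ℝ → ℝ) (x j) ≤ 1 := by
      by_cases hx : x j ∈ K <;> simp [hx]
    have := norm_sub_smul_single_le j (EuclideanSpace.single i (1 : ℝ)) h01.1 h01.2
    rw [PiLp.norm_single, norm_one, mul_one] at this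
    rw [mul_comm]
    gcongr
    exact this

/-- Integration by parts for `f ∘ collapse K j`. -/
theorem integral_comp_collapse_mul_fderiv (hK : IsCompact K) (j : Fin d)
    {f φ : EuclideanSpace ℝ (Fin d) → ℝ} (hf : ContDiff ℝ ∞ f) (hc : HasCompactSupport f)
    (hφ : ContDiff ℝ ∞ φ) (hφc : HasCompactSupport φ) (v : EuclideanSpace ℝ (Fin d)) :
    ∫ x, f (collapse K j x) * fderiv ℝ φ x v
      = - ∫ x, fderiv ℝ f (collapse K j x) (collapseDir K j x v) * φ x := by
  have hδ : ∀ k : ℕ, (0 : ℝ) < 1 / ((k : ℝ) + 1) := fun k => by positivity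
  -- The collapse need not be classically differentiable. Replacing the indicator of `K` by
  -- continuous functions that tend to it pointwise gives differentiable maps `S k`, for which
  -- integration by parts is classical; both sides pass to the limit by dominated convergence.
  set κ : ℕ → ℝ → ℝ := fun k t => (thickenedIndicator (hδ k) K t : ℝ) with hκ
  have hκc : ∀ k, Continuous (κ k) := fun k =>
    NNReal.continuous_coe.comp (thickenedIndicator (hδ k) K).continuous
  have hκ0 : ∀ k t, 0 ≤ κ k t := fun k t => NNReal.coe_nonneg _
  have hκ1 : ∀ k t, κ k t ≤ 1 := fun k t =>
    NNReal.coe_le_one.2 (thickenedIndicator_le_one (hδ k) K t)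
  have hκlim : ∀ t, Tendsto (fun k => κ k t) atTop (𝓝 (K.indicator 1 t)) := by
    intro t
    have h := tendsto_pi_nhds.1 (thickenedIndicator_tendsto_indicator_closure hδ
      tendsto_one_div_add_atTop_nhds_zero_nat K) t
    rw [hK.isClosed.closure_eq] at h
    have h2 := (NNReal.continuous_coe.tendsto _).comp h
    have h3 : ((K.indicator (fun _ => (1 : NNReal)) t : NNReal) : ℝ) = K.indicator 1 t := by
      by_cases ht : t ∈ K <;> simp [ht]
    rwa [h3] at h2
  set m : ℕ → ℝ → ℝ := fun k t => ∫ τ in (0 : ℝ)..t, κ k τ with hm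
  have hmd : ∀ k t, HasDerivAt (m k) (κ k t) t := fun k t =>
    intervalIntegral.integral_hasDerivAt_right ((hκc k).intervalIntegrable _ _)
      ((hκc k).stronglyMeasurableAtFilter _ _) (hκc k).continuousAt
  have hmlim : ∀ t, Tendsto (fun k => m k t) atTop (𝓝 (occupation K t)) := by
    intro t
    refine intervalIntegral.tendsto_integral_filter_of_dominated_convergence (fun _ => (1 : ℝ))
      (Eventually.of_forall fun k => (hκc k).aestronglyMeasurable)
      (Eventually.of_forall fun k => Eventually.of_forall fun x _ => ?_)
      intervalIntegrable_const (Eventually.of_forall fun x _ => hκlim x)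
    rw [Real.norm_of_nonneg (hκ0 k x)]
    exact hκ1 k x
  set e : EuclideanSpace ℝ (Fin d) := EuclideanSpace.single j 1 with he
  set S : ℕ → EuclideanSpace ℝ (Fin d) → EuclideanSpace ℝ (Fin d) :=
    fun k x => x - m k (x j) • e with hS
  set S' : ℕ → EuclideanSpace ℝ (Fin d) → EuclideanSpace ℝ (Fin d) →L[ℝ] EuclideanSpace ℝ (Fin d) :=
    fun k x => ContinuousLinearMap.id ℝ _ -
      (κ k (x j) • (EuclideanSpace.proj (𝕜 := ℝ) j : EuclideanSpace ℝ (Fin d) →L[ℝ] ℝ)).smulRight e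
    with hS'
  have hSd : ∀ k x, HasFDerivAt (S k) (S' k x) x := by
    intro k x
    have h1 : HasFDerivAt (fun x : EuclideanSpace ℝ (Fin d) => x j)
        (EuclideanSpace.proj (𝕜 := ℝ) j : EuclideanSpace ℝ (Fin d) →L[ℝ] ℝ) x :=
      (EuclideanSpace.proj (𝕜 := ℝ) j).hasFDerivAt
    have h2 := (hmd k (x j)).comp_hasFDerivAt x h1
    exact (hasFDerivAt_id x).sub (h2.smul_const e)
  have hSc : ∀ k, Continuous (S k) := fun k =>
    continuous_iff_continuousAt.2 fun x => (hSd k x).continuousAt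
  have hSlim : ∀ x, Tendsto (fun k => S k x) atTop (𝓝 (collapse K j x)) := fun x =>
    tendsto_const_nhds.sub ((hmlim (x j)).smul_const e)
  have hS'v : ∀ k x, S' k x v = v - (κ k (x j) * v j) • e := fun k x => by
    simp [hS']
  have hS'c : ∀ k, Continuous fun x => S' k x v := fun k => by
    simp only [hS'v]
    have := hκc k
    fun_prop
  have hS'lim : ∀ x, Tendsto (fun k => S' k x v) atTop (𝓝 (collapseDir K j x v)) := fun x => by
    simp only [hS'v]
    exact tendsto_const_nhds.sub (((hκlim (x j)).mul_const _).smul_const e)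
  have hfd : ∀ k x, HasFDerivAt (fun x => f (S k x)) ((fderiv ℝ f (S k x)).comp (S' k x)) x :=
    fun k x => ((hf.differentiable (by simp)) (S k x)).hasFDerivAt.comp x (hSd k x)
  have hf'c : Continuous (fderiv ℝ f) := hf.continuous_fderiv (by simp)
  have hφd : Continuous fun x => fderiv ℝ φ x v := by
    have := hφ.continuous_fderiv (by simp)
    fun_prop
  have hφdc : HasCompactSupport fun x => fderiv ℝ φ x v := hφc.fderiv_apply (𝕜 := ℝ) v
  have hcont : ∀ k, Continuous fun x => fderiv ℝ f (S k x) (S' k x v) := fun k =>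
    (hf'c.comp (hSc k)).clm_apply (hS'c k)
  have hcontf : ∀ k, Continuous fun x => f (S k x) := fun k => hf.continuous.comp (hSc k)
  have hibp : ∀ k, ∫ x, f (S k x) * fderiv ℝ φ x v
      = - ∫ x, fderiv ℝ f (S k x) (S' k x v) * φ x := by
    intro k
    have h := integral_mul_fderiv_eq_neg_fderiv_mul_of_integrable (μ := volume)
      (f := fun x => f (S k x)) (g := φ) (v := v) ?_ ?_ ?_ ?_ ?_
    · rw [h]
      simp only [(hfd k _).fderiv, ContinuousLinearMap.comp_apply]
    · simp only [(hfd k _).fderiv, ContinuousLinearMap.comp_apply]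
      exact ((hcont k).mul hφ.continuous).integrable_of_hasCompactSupport hφc.mul_left
    · exact ((hcontf k).mul hφd).integrable_of_hasCompactSupport hφdc.mul_left
    · exact ((hcontf k).mul hφ.continuous).integrable_of_hasCompactSupport hφc.mul_left
    · exact fun x _ => (hfd k x).differentiableAt
    · exact fun x _ => hφ.differentiable (by simp) x
  obtain ⟨C, hC⟩ := hc.exists_bound_of_continuous hf.continuous
  obtain ⟨C', hC'⟩ := (hc.fderiv (𝕜 := ℝ)).exists_bound_of_continuous hf'c
  have hC'0 : 0 ≤ C' := (norm_nonneg _).trans (hC' 0)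
  have hl : Tendsto (fun k => ∫ x, f (S k x) * fderiv ℝ φ x v) atTop
      (𝓝 (∫ x, f (collapse K j x) * fderiv ℝ φ x v)) := by
    refine tendsto_integral_of_dominated_convergence (fun x => C * ‖fderiv ℝ φ x v‖)
      (fun k => ((hcontf k).mul hφd).aestronglyMeasurable)
      ((hφd.integrable_of_hasCompactSupport hφdc).norm.const_mul _)
      (fun k => Eventually.of_forall fun x => ?_) (Eventually.of_forall fun x => ?_)
    · rw [norm_mul]
      gcongr
      exact hC _
    · exact ((hf.continuous.tendsto _).comp (hSlim x)).mul_const _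
  have hr : Tendsto (fun k => ∫ x, fderiv ℝ f (S k x) (S' k x v) * φ x) atTop
      (𝓝 (∫ x, fderiv ℝ f (collapse K j x) (collapseDir K j x v) * φ x)) := by
    refine tendsto_integral_of_dominated_convergence (fun x => C' * (2 * ‖v‖) * ‖φ x‖)
      (fun k => ((hcont k).mul hφ.continuous).aestronglyMeasurable)
      ((hφ.continuous.integrable_of_hasCompactSupport hφc).norm.const_mul _)
      (fun k => Eventually.of_forall fun x => ?_) (Eventually.of_forall fun x => ?_)
    · rw [norm_mul]
      gcongr
      refine (ContinuousLinearMap.le_opNorm _ _).trans ?_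
      rw [hS'v]
      gcongr
      · exact hC' _
      · exact norm_sub_smul_single_le j v (hκ0 k _) (hκ1 k _)
    · have h : Tendsto (fun k => fderiv ℝ f (S k x)) atTop (𝓝 (fderiv ℝ f (collapse K j x))) :=
        (hf'c.tendsto _).comp (hSlim x)
      have h2 : Tendsto (fun k => fderiv ℝ f (S k x) (S' k x v)) atTop
          (𝓝 (fderiv ℝ f (collapse K j x) (collapseDir K j x v))) :=
        (isBoundedBilinearMap_apply.continuous.tendsto (_, _)).comp (h.prodMk_nhds (hS'lim x))
      exact h2.mul_const _
  refine tendsto_nhds_unique hl ?_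
  simp only [hibp]
  exact hr.neg

end Collapse

end

/-! ### L² on the closed domain and closedness of the weak gradient -/

noncomputable section

section Closure

variable {d : ℕ}

theorem measurableEmbedding_closure (Γ : Set (EuclideanSpace ℝ (Fin d))) :
    MeasurableEmbedding (Subtype.val : closure Γ → EuclideanSpace ℝ (Fin d)) :=
  MeasurableEmbedding.subtype_coe isClosed_closure.measurableSet

theorem map_closureMeasure (Γ : Set (EuclideanSpace ℝ (Fin d))) :
    (closureMeasure Γ).map Subtype.val = volume.restrict (closure Γ) :=
  map_comap_subtype_coe isClosed_closure.measurableSet _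

theorem eLpNorm_comp_val {Γ : Set (EuclideanSpace ℝ (Fin d))}
    (F : EuclideanSpace ℝ (Fin d) → ℝ) :
    eLpNorm (fun y : closure Γ => F y) 2 (closureMeasure Γ)
      = eLpNorm F 2 (volume.restrict (closure Γ)) := by
  rw [← map_closureMeasure, (measurableEmbedding_closure Γ).eLpNorm_map_measure]
  rfl

theorem MeasureTheory.MemLp.comp_val {F : EuclideanSpace ℝ (Fin d) → ℝ} (hF : MemLp F 2)
    (Γ : Set (EuclideanSpace ℝ (Fin d))) :
    MemLp (fun y : closure Γ => F y) 2 (closureMeasure Γ) := by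
  have h := hF.restrict (closure Γ)
  rw [← map_closureMeasure, (measurableEmbedding_closure Γ).memLp_map_measure_iff] at h
  exact h

theorem setIntegral_closureMeasure {Γ : Set (EuclideanSpace ℝ (Fin d))}
    (F : EuclideanSpace ℝ (Fin d) → ℝ) :
    ∫ y in {y : closure Γ | (y : EuclideanSpace ℝ (Fin d)) ∈ Γ}, F y ∂(closureMeasure Γ)
      = ∫ x in Γ, F x := by
  have h := (measurableEmbedding_closure Γ).setIntegral_map (μ := closureMeasure Γ) F Γ
  rw [map_closureMeasure, Measure.restrict_restrict_of_subset subset_closure] at h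
  exact h.symm

theorem ae_closureMeasure {Γ : Set (EuclideanSpace ℝ (Fin d))}
    {p : EuclideanSpace ℝ (Fin d) → Prop} (h : ∀ᵐ x ∂(volume.restrict (closure Γ)), p x) :
    ∀ᵐ y : closure Γ ∂(closureMeasure Γ), p y := by
  rw [← map_closureMeasure] at h
  exact ae_of_ae_map measurable_subtype_coe.aemeasurable h

/-- An `L²` estimate for functions that agree off a compact set. -/
theorem norm_sub_le_of_forall_abs_sub_le {Γ k : Set (EuclideanSpace ℝ (Fin d))} (hk : IsCompact k)
    {u v : Lp ℝ 2 (closureMeasure Γ)} {F G : EuclideanSpace ℝ (Fin d) → ℝ}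
    (hu : u =ᵐ[closureMeasure Γ] fun y => F y) (hv : v =ᵐ[closureMeasure Γ] fun y => G y)
    (h0 : ∀ x ∉ k, F x = G x) {ε : ℝ} (hε : 0 ≤ ε) (h : ∀ x, |F x - G x| ≤ ε) :
    ‖u - v‖ ≤ ε * ((volume k) ^ (1 / (2 : ENNReal).toReal)).toReal := by
  have h1 : u - v =ᵐ[closureMeasure Γ] fun y => F y - G y := by
    filter_upwards [Lp.coeFn_sub u v, hu, hv] with y h1 h2 h3
    rw [h1, Pi.sub_apply, h2, h3]
  have hle : ∀ x, ‖F x - G x‖ ≤ ‖k.indicator (fun _ => ε) x‖ := by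
    intro x
    by_cases hx : x ∈ k
    · rw [Set.indicator_of_mem hx, Real.norm_of_nonneg hε]
      exact h x
    · rw [h0 x hx, sub_self, norm_zero]
      positivity
  have hfin : (volume k) ^ (1 / (2 : ENNReal).toReal) ≠ ⊤ :=
    ENNReal.rpow_ne_top_of_nonneg (by positivity) hk.measure_lt_top.ne
  rw [Lp.norm_def, eLpNorm_congr_ae h1, eLpNorm_comp_val (fun x => F x - G x)]
  have h2 := ((eLpNorm_mono_measure (p := 2) (fun x => F x - G x)
    (Measure.restrict_le_self (μ := volume) (s := closure Γ))).trans (eLpNorm_mono hle))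
  rw [eLpNorm_indicator_const hk.measurableSet (by norm_num) (by norm_num),
    Real.enorm_of_nonneg hε] at h2
  have h3 := ENNReal.toReal_mono (ENNReal.mul_ne_top ENNReal.ofReal_ne_top hfin) h2
  rwa [ENNReal.toReal_mul, ENNReal.toReal_ofReal hε] at h3

/-- The weak gradient is a closed operator. -/
theorem isClosed_weakGradientGraph {Γ : Set (EuclideanSpace ℝ (Fin d))} (hΓ : IsOpen Γ) :
    IsClosed (weakGradientGraph Γ : Set (Lp ℝ 2 (closureMeasure Γ) ×
      Lp (EuclideanSpace ℝ (Fin d)) 2 (volume.restrict Γ))) := by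
  have hset : (weakGradientGraph Γ : Set (Lp ℝ 2 (closureMeasure Γ) ×
      Lp (EuclideanSpace ℝ (Fin d)) 2 (volume.restrict Γ))) = {p | IsWeakGradient Γ p.1 p.2} := rfl
  simp only [hset, IsWeakGradient, Set.ofPred_forall]
  refine isClosed_iInter fun φ => isClosed_iInter fun hφ => isClosed_iInter fun hc =>
    isClosed_iInter fun hs => isClosed_iInter fun i => ?_
  set e : EuclideanSpace ℝ (Fin d) := EuclideanSpace.single i 1 with he
  have hφd : Continuous fun x => fderiv ℝ φ x e := by
    have := hφ.continuous_fderiv (by simp)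
    fun_prop
  -- Each identity defining a weak gradient equates two continuous functionals, namely inner
  -- products with fixed elements of L², so it defines a closed set.
  have m1 : MemLp (Γ.indicator fun x => fderiv ℝ φ x e) 2 :=
    (hφd.memLp_of_hasCompactSupport (hc.fderiv_apply (𝕜 := ℝ) e)).indicator hΓ.measurableSet
  have m2 : MemLp (fun x => φ x • e) 2 (volume.restrict Γ) :=
    (hφ.continuous.smul continuous_const).memLp_of_hasCompactSupport hc.smul_right
  have e1 : ∀ u : Lp ℝ 2 (closureMeasure Γ),
      ∫ y in {y : closure Γ | (y : EuclideanSpace ℝ (Fin d)) ∈ Γ},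
          u y * fderiv ℝ φ y e ∂(closureMeasure Γ)
        = inner ℝ (m1.comp_val Γ).toLp u := by
    intro u
    have hΓ' : MeasurableSet {y : closure Γ | (y : EuclideanSpace ℝ (Fin d)) ∈ Γ} :=
      measurable_subtype_coe hΓ.measurableSet
    rw [L2.inner_def, ← integral_indicator hΓ']
    refine integral_congr_ae ?_
    filter_upwards [(m1.comp_val Γ).coeFn_toLp] with y hy
    rw [hy]
    by_cases hyΓ : (y : EuclideanSpace ℝ (Fin d)) ∈ Γ <;> simp [Set.indicator, hyΓ]
  have e2 : ∀ g : Lp (EuclideanSpace ℝ (Fin d)) 2 (volume.restrict Γ),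
      ∫ x in Γ, g x i * φ x = inner ℝ m2.toLp g := by
    intro g
    rw [L2.inner_def]
    refine integral_congr_ae ?_
    filter_upwards [m2.coeFn_toLp] with x hx
    rw [hx, real_inner_smul_left, he, EuclideanSpace.inner_single_left]
    simp [mul_comm]
  simp only [e1, e2]
  exact isClosed_eq (by fun_prop) (by fun_prop)

end Closure

/-! ### The core of collapsed functions and the unit contraction -/

section CollapsedGraph

variable {d : ℕ} {K : Set ℝ}

theorem fderiv_comp_real {f : EuclideanSpace ℝ (Fin d) → ℝ} {φ : ℝ → ℝ} (hf : ContDiff ℝ ∞ f)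
    (hφ : ContDiff ℝ ∞ φ) (x : EuclideanSpace ℝ (Fin d)) :
    fderiv ℝ (fun x => φ (f x)) x = deriv φ (f x) • fderiv ℝ f x :=
  (((hφ.differentiable (by simp)) (f x)).hasDerivAt.comp_hasFDerivAt x
    ((hf.differentiable (by simp)) x).hasFDerivAt).fderiv

/-- The linear space of all pairs `(f ∘ collapse K j, ∇(f ∘ collapse K j))` with `f` smooth and
compactly supported. -/
def collapsedGraph (Γ : Set (EuclideanSpace ℝ (Fin d))) (K : Set ℝ) (j : Fin d) :
    Submodule ℝ (Lp ℝ 2 (closureMeasure Γ) ×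
      Lp (EuclideanSpace ℝ (Fin d)) 2 (volume.restrict Γ)) where
  carrier := {p | ∃ f : EuclideanSpace ℝ (Fin d) → ℝ, ContDiff ℝ ∞ f ∧ HasCompactSupport f ∧
    p.1 =ᵐ[closureMeasure Γ] (fun y => f (collapse K j y)) ∧
    p.2 =ᵐ[volume.restrict Γ] collapseGradient K j f}
  zero_mem' := by
    refine ⟨0, contDiff_const, HasCompactSupport.zero, Lp.coeFn_zero _ _ _, ?_⟩
    filter_upwards [Lp.coeFn_zero (EuclideanSpace ℝ (Fin d)) 2 (volume.restrict Γ)] with x hx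
    simp only [Prod.snd_zero, hx]
    ext i
    simp [collapseGradient_apply]
  add_mem' := by
    rintro ⟨u, g⟩ ⟨v, h⟩ ⟨f₁, hf₁, hc₁, hu, hg⟩ ⟨f₂, hf₂, hc₂, hv, hh⟩
    refine ⟨f₁ + f₂, hf₁.add hf₂, hc₁.add hc₂, ?_, ?_⟩
    · filter_upwards [Lp.coeFn_add u v, hu, hv] with y h1 h2 h3
      simp only [Prod.mk_add_mk, h1, Pi.add_apply, h2, h3]
    · filter_upwards [Lp.coeFn_add g h, hg, hh] with x h1 h2 h3
      simp only [Prod.mk_add_mk, h1, Pi.add_apply, h2, h3]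
      ext i
      have := fderiv_add (hf₁.differentiable (by simp) (collapse K j x))
        (hf₂.differentiable (by simp) (collapse K j x))
      simp [collapseGradient_apply, this]
  smul_mem' := by
    rintro c ⟨u, g⟩ ⟨f, hf, hc, hu, hg⟩
    refine ⟨c • f, contDiff_const.smul hf, hc.smul_left, ?_, ?_⟩
    · filter_upwards [Lp.coeFn_smul c u, hu] with y h1 h2
      simp only [Prod.smul_mk, h1, Pi.smul_apply, h2]
    · filter_upwards [Lp.coeFn_smul c g, hg] with x h1 h2
      simp only [Prod.smul_mk, h1, Pi.smul_apply, h2]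
      ext i
      have := fderiv_const_smul (hf.differentiable (by simp) (collapse K j x)) c
      simp [collapseGradient_apply, this]

theorem exists_mem_collapsedGraph (Γ : Set (EuclideanSpace ℝ (Fin d))) (hK : IsCompact K)
    (hKi : interior K = ∅) (j : Fin d) {f : EuclideanSpace ℝ (Fin d) → ℝ} (hf : ContDiff ℝ ∞ f)
    (hc : HasCompactSupport f) : ∃ p ∈ collapsedGraph Γ K j,
      p.1 =ᵐ[closureMeasure Γ] (fun y => f (collapse K j y)) ∧
      p.2 =ᵐ[volume.restrict Γ] collapseGradient K j f := by
  have h1 : MemLp (fun x => f (collapse K j x)) 2 :=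
    (hf.continuous.comp (continuous_collapse hK.measurableSet j)).memLp_of_hasCompactSupport
      (hc.comp_collapse hK hKi j)
  have h2 := (memLp_collapseGradient hK hKi j hf hc).restrict Γ
  exact ⟨((h1.comp_val Γ).toLp, h2.toLp),
    ⟨f, hf, hc, (h1.comp_val Γ).coeFn_toLp, h2.coeFn_toLp⟩,
    (h1.comp_val Γ).coeFn_toLp, h2.coeFn_toLp⟩

/-- Test functions are supported in `Γ`, so both integrals extend to the whole space, where
integration by parts for the collapse applies; the boundary plays no role. -/
theorem collapsedGraph_le (Γ : Set (EuclideanSpace ℝ (Fin d))) (hK : IsCompact K) (j : Fin d) :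
    collapsedGraph Γ K j ≤ weakGradientGraph Γ := by
  rintro ⟨u, g⟩ ⟨f, hf, hc, hu, hg⟩ φ hφ hφc hφs i
  set e : EuclideanSpace ℝ (Fin d) := EuclideanSpace.single i 1 with he
  have h1 : ∫ y in {y : closure Γ | (y : EuclideanSpace ℝ (Fin d)) ∈ Γ},
      u y * fderiv ℝ φ y e ∂(closureMeasure Γ)
      = ∫ x, f (collapse K j x) * fderiv ℝ φ x e := by
    rw [integral_congr_ae (g := fun y : closure Γ => f (collapse K j y) * fderiv ℝ φ y e),
      setIntegral_closureMeasure (fun x => f (collapse K j x) * fderiv ℝ φ x e),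
      setIntegral_eq_integral_of_forall_compl_eq_zero]
    · intro x hx
      have : fderiv ℝ φ x = 0 := by
        by_contra h
        exact hx (hφs (support_fderiv_subset ℝ h))
      simp [this]
    · filter_upwards [ae_restrict_of_ae hu] with y hy
      simp only [hy]
  have h2 : ∫ x in Γ, g x i * φ x
      = ∫ x, fderiv ℝ f (collapse K j x) (collapseDir K j x e) * φ x := by
    rw [integral_congr_ae (g := fun x => fderiv ℝ f (collapse K j x) (collapseDir K j x e) * φ x),
      setIntegral_eq_integral_of_forall_compl_eq_zero]
    · intro x hx
      rw [image_eq_zero_of_notMem_tsupport fun h => hx (hφs h), mul_zero]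
    · filter_upwards [hg] with x hx
      simp only [hx, collapseGradient_apply, he]
  rw [h1, h2]
  exact integral_comp_collapse_mul_fderiv hK j hf hc hφ hφc e

/-- Together with uniqueness of weak gradients, this shows that the closure of the core is still the
graph of an operator. -/
theorem closure_collapsedGraph_le {Γ : Set (EuclideanSpace ℝ (Fin d))} (hΓ : IsOpen Γ)
    (hK : IsCompact K) (j : Fin d) :
    (collapsedGraph Γ K j).topologicalClosure ≤ weakGradientGraph Γ :=
  Submodule.topologicalClosure_minimal _ (collapsedGraph_le Γ hK j) (isClosed_weakGradientGraph hΓ)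

theorem lipschitzWith_unitContraction : LipschitzWith 1 fun t : ℝ => min (max t 0) 1 :=
  (LipschitzWith.id.max_const 0).min_const 1

/-- The unit contraction as a map of `L²`. -/
def unitContraction {X : Type*} [MeasurableSpace X] {m : Measure X} (u : Lp ℝ 2 m) : Lp ℝ 2 m :=
  lipschitzWith_unitContraction.compLp (by simp) u

theorem coeFn_unitContraction {X : Type*} [MeasurableSpace X] {m : Measure X} (u : Lp ℝ 2 m) :
    unitContraction u =ᵐ[m] fun x => min (max (u x) 0) 1 :=
  lipschitzWith_unitContraction.coeFn_compLp (by simp) u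

theorem continuous_unitContraction {X : Type*} [MeasurableSpace X] {m : Measure X} :
    Continuous (unitContraction : Lp ℝ 2 m → Lp ℝ 2 m) :=
  lipschitzWith_unitContraction.continuous_compLp (by simp)

/-- Approximate the unit contraction uniformly by smooth `φ k` with `φ k 0 = 0` and slope at most
`1`. Composing `f` with `φ k` stays in the core, the supports stay in one compact set, so the
functions converge in L², and the chain rule does not increase the gradient norm. -/
theorem exists_unitContraction_mem_of_mem_collapsedGraph {Γ : Set (EuclideanSpace ℝ (Fin d))}
    (hK : IsCompact K) (hKi : interior K = ∅) {j : Fin d}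
    {p : Lp ℝ 2 (closureMeasure Γ) × Lp (EuclideanSpace ℝ (Fin d)) 2 (volume.restrict Γ)}
    (hp : p ∈ collapsedGraph Γ K j) :
    ∃ h, (unitContraction p.1, h) ∈ (collapsedGraph Γ K j).topologicalClosure ∧
      ‖h‖ ≤ ‖p.2‖ := by
  obtain ⟨f, hf, hc, hu, hg⟩ := hp
  have hex := fun k : ℕ => exists_contDiff_abs_deriv_le_one_abs_sub_unitContraction_le
    (ε := 1 / ((k : ℝ) + 1)) (by positivity)
  choose φ hφ hφ0 hφd hφc using hex
  have hcomp : ∀ k, ContDiff ℝ ∞ fun x => φ k (f x) := fun k => (hφ k).comp hf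
  have hcs : ∀ k, HasCompactSupport fun x => φ k (f x) := fun k => hc.comp_left (hφ0 k)
  choose q hqD hq1 hq2 using fun k => exists_mem_collapsedGraph Γ hK hKi j (hcomp k) (hcs k)
  set k₀ := tsupport (f ∘ collapse K j)
  have hk₀ : IsCompact k₀ := hc.comp_collapse hK hKi j
  have hlim : Tendsto (fun k => (q k).1) atTop (𝓝 (unitContraction p.1)) := by
    rw [tendsto_iff_norm_sub_tendsto_zero]
    refine squeeze_zero (fun k => norm_nonneg _)
      (g := fun k : ℕ => 1 / ((k : ℝ) + 1) * ((volume k₀) ^ (1 / (2 : ENNReal).toReal)).toReal)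
      (fun k => ?_) ?_
    · refine norm_sub_le_of_forall_abs_sub_le hk₀
        (F := fun x => φ k (f (collapse K j x))) (hq1 k)
        (G := fun x => min (max (f (collapse K j x)) 0) 1) ?_ ?_ (by positivity) ?_
      · filter_upwards [coeFn_unitContraction p.1, hu] with y h1 h2
        rw [h1, h2]
      · intro x hx
        have : f (collapse K j x) = 0 :=
          image_eq_zero_of_notMem_tsupport (f := f ∘ collapse K j) hx
        simp [this, hφ0]
      · exact fun x => hφc k _
    · simpa using tendsto_one_div_add_atTop_nhds_zero_nat.mul_const
        ((volume k₀) ^ (1 / (2 : ENNReal).toReal)).toReal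
  refine Submodule.exists_mem_of_tendsto_fst_of_norm_snd_le
    (Submodule.isClosed_topologicalClosure _)
    (fun k => Submodule.le_topologicalClosure _ (hqD k)) hlim fun k => ?_
  refine Lp.norm_le_norm_of_ae_le ?_
  filter_upwards [hq2 k, hg] with x h1 h2
  have h3 : collapseGradient K j (fun x => φ k (f x)) x
      = deriv (φ k) (f (collapse K j x)) • collapseGradient K j f x := by
    ext i
    simp [collapseGradient_apply, fderiv_comp_real hf (hφ k)]
  rw [h1, h2, h3, norm_smul]
  exact mul_le_of_le_one_left (norm_nonneg _) (hφd k _)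

/-- Approximation by the core only gives the bound `‖p.2‖ + ε`. The weak gradient is unique, so the
same element satisfies it for every `ε`. -/
theorem exists_unitContraction_mem_closure {Γ : Set (EuclideanSpace ℝ (Fin d))} (hΓ : IsOpen Γ)
    (hK : IsCompact K) (hKi : interior K = ∅) {j : Fin d}
    {p : Lp ℝ 2 (closureMeasure Γ) × Lp (EuclideanSpace ℝ (Fin d)) 2 (volume.restrict Γ)}
    (hp : p ∈ (collapsedGraph Γ K j).topologicalClosure) :
    ∃ h, (unitContraction p.1, h) ∈ (collapsedGraph Γ K j).topologicalClosure ∧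
      ‖h‖ ≤ ‖p.2‖ := by
  obtain ⟨q, hqD, hq⟩ := mem_closure_iff_seq_limit.1 hp
  choose h hhW hhn using fun k => exists_unitContraction_mem_of_mem_collapsedGraph hK hKi (hqD k)
  have h1 : Tendsto (fun k => unitContraction (q k).1) atTop (𝓝 (unitContraction p.1)) :=
    (continuous_unitContraction.tendsto _).comp ((continuous_fst.tendsto _).comp hq)
  have h2 : Tendsto (fun k => ‖(q k).2‖) atTop (𝓝 ‖p.2‖) :=
    ((continuous_snd.tendsto _).comp hq).norm
  have key : ∀ ε > 0, ∃ b, (unitContraction p.1, b) ∈ (collapsedGraph Γ K j).topologicalClosure ∧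
      ‖b‖ ≤ ‖p.2‖ + ε := by
    intro ε hε
    obtain ⟨N, hN⟩ := eventually_atTop.1 (h2.eventually_le_const (lt_add_of_pos_right ‖p.2‖ hε))
    exact Submodule.exists_mem_of_tendsto_fst_of_norm_snd_le
      (Submodule.isClosed_topologicalClosure _) (fun k => hhW (k + N))
      (h1.comp (tendsto_add_atTop_nat N))
      fun k => (hhn _).trans (hN _ (Nat.le_add_left _ _))
  obtain ⟨b, hb, -⟩ := key 1 one_pos
  refine ⟨b, hb, le_of_forall_pos_le_add fun ε hε => ?_⟩
  obtain ⟨b', hb', hle⟩ := key ε hε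
  have : b = b' := IsWeakGradient.unique hΓ (closure_collapsedGraph_le hΓ hK j hb)
    (closure_collapsedGraph_le hΓ hK j hb')
  rwa [this]

end CollapsedGraph

end

/-! ### Regularity of the closure of the core -/

noncomputable section

section Regular

variable {d : ℕ} {K : Set ℝ}

/-- A compactly supported continuous function on a closed subspace extends to a compactly supported
continuous function. -/
theorem HasCompactSupport.exists_extension {X : Type*} [TopologicalSpace X] [T2Space X]
    [NormalSpace X] [LocallyCompactSpace X] {s : Set X} (hs : IsClosed s) {f : s → ℝ}
    (hf : Continuous f) (hc : HasCompactSupport f) :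
    ∃ g : X → ℝ, Continuous g ∧ HasCompactSupport g ∧ ∀ x : s, g x = f x := by
  obtain ⟨g, hg⟩ := ContinuousMap.exists_restrict_eq hs ⟨f, hf⟩
  have hg' : ∀ x : s, g x = f x := fun x => DFunLike.congr_fun hg x
  -- The Tietze extension `g` need not have compact support; a cutoff equal to `1` on the support of
  -- `f` repairs this without changing the values on `s`.
  obtain ⟨χ, hχ1, -, hχc, -⟩ := exists_continuous_one_zero_of_isCompact
    (hc.isCompact.image continuous_subtype_val) isClosed_empty (Set.disjoint_empty _)
  refine ⟨fun x => χ x * g x, χ.continuous.mul g.continuous, hχc.mul_right, fun x => ?_⟩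
  simp only [hg']
  by_cases hx : x ∈ tsupport f
  · have : χ x = 1 := hχ1 (Set.mem_image_of_mem _ hx)
    rw [this, one_mul]
  · rw [image_eq_zero_of_notMem_tsupport hx, mul_zero]

/-- A function in `L²(closure Γ)`, extended by zero. -/
theorem exists_measurable_extension {Γ : Set (EuclideanSpace ℝ (Fin d))}
    (u : Lp ℝ 2 (closureMeasure Γ)) : ∃ U : EuclideanSpace ℝ (Fin d) → ℝ,
      Measurable U ∧ MemLp U 2 ∧ ∀ y : closure Γ, u y = U y := by
  have hm : Measurable u := (Lp.stronglyMeasurable u).measurable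
  set U := Function.extend (Subtype.val : closure Γ → EuclideanSpace ℝ (Fin d)) u 0 with hU
  have hUm : Measurable U := (measurableEmbedding_closure Γ).measurable_extend hm measurable_zero
  have hUu : ∀ y : closure Γ, u y = U y := fun y =>
    (Subtype.val_injective.extend_apply _ _ _).symm
  refine ⟨U, hUm, ?_, hUu⟩
  have hind : U = (closure Γ).indicator U := by
    ext x
    by_cases hx : x ∈ closure Γ
    · rw [Set.indicator_of_mem hx]
    · rw [Set.indicator_of_notMem hx, hU, Function.extend_apply' _ _ _ (by simpa using hx)]
      rfl
  rw [hind, memLp_indicator_iff_restrict isClosed_closure.measurableSet, ← map_closureMeasure,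
    (measurableEmbedding_closure Γ).memLp_map_measure_iff]
  exact (Lp.memLp u).congr_norm (hUm.comp measurable_subtype_coe).aestronglyMeasurable
    (Eventually.of_forall fun y => by rw [hUu, Function.comp_apply])

/-- The functions `f ∘ collapse K j`, with `f` smooth and compactly supported, approximate
compactly supported continuous functions uniformly, with supports in a fixed compact set. -/
theorem HasCompactSupport.exists_abs_sub_comp_collapse_lt (hK : IsCompact K)
    (hKi : interior K = ∅) (j : Fin d) {h : EuclideanSpace ℝ (Fin d) → ℝ} (hc : HasCompactSupport h)
    (hh : Continuous h) : ∃ k : Set (EuclideanSpace ℝ (Fin d)), IsCompact k ∧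
      (∀ x ∉ k, h x = 0) ∧ ∀ ε > 0, ∃ f : EuclideanSpace ℝ (Fin d) → ℝ,
      ContDiff ℝ ∞ f ∧ HasCompactSupport f ∧ (∀ x ∉ k, f (collapse K j x) = 0) ∧
      ∀ x, |h x - f (collapse K j x)| < ε := by
  -- Approximate `h ∘ S⁻¹` by smooth functions and pull back along `S`: uniform errors are
  -- unchanged, and the preimage of a compact set is compact.
  obtain ⟨S, hSx⟩ : ∃ S : EuclideanSpace ℝ (Fin d) ≃ₜ EuclideanSpace ℝ (Fin d),
      ∀ x, S x = collapse K j x := ⟨collapseHomeomorph hK hKi j, fun _ => rfl⟩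
  have hc' : HasCompactSupport (h ∘ S.symm) := hc.comp_isClosedEmbedding S.symm.isClosedEmbedding
  set k' := Metric.cthickening 1 (tsupport (h ∘ S.symm)) with hk'
  have hk'c : IsCompact k' := hc'.isCompact.cthickening
  refine ⟨S ⁻¹' k', S.isClosedEmbedding.isCompact_preimage hk'c, fun x hx => ?_, fun ε hε => ?_⟩
  · by_contra h0
    have h1 : S x ∈ tsupport (h ∘ S.symm) :=
      subset_tsupport (h ∘ S.symm) (by simpa using h0)
    have h2 : S x ∈ k' := Metric.self_subset_cthickening (tsupport (h ∘ S.symm)) h1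
    exact hx h2
  · obtain ⟨f, hf, hfc, hf0, hfe⟩ :=
      hc'.exists_contDiff_abs_sub_lt (hh.comp S.symm.continuous) hε
    refine ⟨f, hf, hfc, fun x hx => hf0 _ (by rwa [← hSx]), fun x => ?_⟩
    have := hfe (S x)
    rwa [Function.comp_apply, S.symm_apply_apply, hSx] at this

/-- The form `u, v ↦ ½ ∫_Γ ∇u · ∇v dx` on the closure of the smooth functions of `collapse K j` is
a regular Dirichlet form. -/
theorem L2Form.isRegularDirichletForm_of_mem_domain_iff {Γ : Set (EuclideanSpace ℝ (Fin d))}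
    (hΓ : IsOpen Γ) (hK : IsCompact K) (hKi : interior K = ∅) (j : Fin d)
    (Q : L2Form (closureMeasure Γ))
    (hdom : ∀ u, u ∈ Q.domain ↔ ∃ g, (u, g) ∈ (collapsedGraph Γ K j).topologicalClosure)
    (hform : ∀ u v : Q.domain, ∀ g h, IsWeakGradient Γ u g → IsWeakGradient Γ v h →
      Q.form u v = (1 / 2) * inner ℝ g h) : Q.IsRegularDirichletForm := by
  set W := (collapsedGraph Γ K j).topologicalClosure with hW
  have hWle : ∀ {u g}, (u, g) ∈ W → IsWeakGradient Γ u g := fun h =>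
    closure_collapsedGraph_le hΓ hK j h
  have hWc : IsClosed (W : Set (Lp ℝ 2 (closureMeasure Γ) ×
      Lp (EuclideanSpace ℝ (Fin d)) 2 (volume.restrict Γ))) :=
    Submodule.isClosed_topologicalClosure _
  have hgrad : ∀ u : Q.domain, ∃ g, ((u : Lp ℝ 2 (closureMeasure Γ)), g) ∈ W := fun u =>
    (hdom u).1 u.2
  have hself : ∀ (u : Q.domain) g, ((u : Lp ℝ 2 (closureMeasure Γ)), g) ∈ W →
      Q.form u u = (1 / 2) * ‖g‖ ^ 2 := fun u g hg => by
    rw [hform u u g g (hWle hg) (hWle hg), real_inner_self_eq_norm_sq]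
  have hone : ∀ (u v : Q.domain) g h, ((u : Lp ℝ 2 (closureMeasure Γ)), g) ∈ W →
      ((v : Lp ℝ 2 (closureMeasure Γ)), h) ∈ W → Q.formOne (u - v) (u - v)
        = (1 / 2) * ‖g - h‖ ^ 2 + ‖(u : Lp ℝ 2 (closureMeasure Γ)) - v‖ ^ 2 := by
    intro u v g h hg hh
    rw [L2Form.formOne, hself (u - v) (g - h) (W.sub_mem hg hh), real_inner_self_eq_norm_sq]
    rfl
  have hcont : ∀ f : EuclideanSpace ℝ (Fin d) → ℝ, ContDiff ℝ ∞ f → HasCompactSupport f →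
      Continuous (fun y : closure Γ => f (collapse K j y)) ∧
      HasCompactSupport (fun y : closure Γ => f (collapse K j y)) := fun f hf hc =>
    ⟨(hf.continuous.comp (continuous_collapse hK.measurableSet j)).comp continuous_subtype_val,
      (hc.comp_collapse hK hKi j).comp_isClosedEmbedding
        isClosed_closure.isClosedEmbedding_subtypeVal⟩
  refine
  { dense_domain := ?_
    symm := ?_
    nonneg := ?_
    closed := ?_
    markovian := ?_
    dense_form := ?_
    dense_uniform := ?_ }
  -- Two approximations: an L² function by a compactly supported continuous `h`, then `h` uniformly
  -- by a core function with support in a fixed compact set.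
  · rw [Metric.dense_iff]
    intro u r hr
    obtain ⟨U, -, hUL, hU⟩ := exists_measurable_extension u
    obtain ⟨h, hc, hUh, hh, hhL⟩ := hUL.exists_hasCompactSupport_eLpNorm_sub_le
      (by norm_num) (ε := ENNReal.ofReal (r / 4)) (by simpa using hr)
    have hfL := hhL.comp_val Γ
    obtain ⟨k, hk, hhk, happ⟩ := hc.exists_abs_sub_comp_collapse_lt hK hKi j hh
    have hfL' : hfL.toLp =ᵐ[closureMeasure Γ] fun y => h y := hfL.coeFn_toLp
    set C := ((volume k) ^ (1 / (2 : ENNReal).toReal)).toReal with hC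
    have hC0 : 0 ≤ C := ENNReal.toReal_nonneg
    -- On the compact set `k` the uniform tolerance is multiplied by `C = |k|^{1/2}`; the
    -- denominator `C + 1` makes the result at most `r / 4`, even if `C = 0`.
    obtain ⟨g, hg, hgc, hgk, hgh⟩ := happ (r / (4 * (C + 1))) (by positivity)
    obtain ⟨p, hpD, hp1, -⟩ := exists_mem_collapsedGraph Γ hK hKi j hg hgc
    have d1 : ‖hfL.toLp - p.1‖ ≤ r / (4 * (C + 1)) * C :=
      norm_sub_le_of_forall_abs_sub_le hk hfL' (G := fun x => g (collapse K j x)) hp1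
        (fun x hx => by rw [hhk x hx, hgk x hx]) (by positivity) fun x => (hgh x).le
    have d1' : r / (4 * (C + 1)) * C ≤ r / 4 := by
      rw [div_mul_eq_mul_div, div_le_div_iff₀ (by positivity) (by positivity)]
      nlinarith
    have d2 : ‖u - hfL.toLp‖ ≤ r / 4 := by
      rw [← Lp.toLp_coeFn u (Lp.memLp u), ← MemLp.toLp_sub, Lp.norm_toLp]
      refine ENNReal.toReal_le_of_le_ofReal (by positivity) ?_
      have he : (u - fun y : closure Γ => h y : closure Γ → ℝ) = fun y : closure Γ => (U - h) y := by
        ext y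
        simp [hU]
      rw [he, eLpNorm_comp_val]
      exact (eLpNorm_mono_measure _ Measure.restrict_le_self).trans hUh
    refine ⟨p.1, ?_, (hdom _).2 ⟨p.2, Submodule.le_topologicalClosure _ hpD⟩⟩
    rw [Metric.mem_ball, dist_comm, dist_eq_norm]
    calc ‖u - p.1‖ ≤ ‖u - hfL.toLp‖ + ‖hfL.toLp - p.1‖ := norm_sub_le_norm_sub_add_norm_sub _ _ _
      _ < r := by linarith
  · intro u v
    obtain ⟨g, hg⟩ := hgrad u
    obtain ⟨h, hh⟩ := hgrad v
    rw [hform u v g h (hWle hg) (hWle hh), hform v u h g (hWle hh) (hWle hg), real_inner_comm]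
  · intro u
    obtain ⟨g, hg⟩ := hgrad u
    rw [hself u g hg]
    positivity
  · intro u hu
    choose g hg using fun k => hgrad (u k)
    have hcau : ∀ ε > 0, ∃ N, ∀ k ≥ N, ∀ l ≥ N,
        ‖g k - g l‖ < ε ∧ ‖((u k : Lp ℝ 2 (closureMeasure Γ))) - u l‖ < ε := by
      intro ε hε
      -- The factor `1 / 2` in front of the gradient term dictates this tolerance.
      obtain ⟨N, hN⟩ := hu (ε ^ 2 / 2) (by positivity)
      refine ⟨N, fun k hk l hl => ?_⟩
      have h1 := hN k hk l hl
      rw [hone _ _ _ _ (hg k) (hg l)] at h1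
      constructor
      · refine lt_of_pow_lt_pow_left₀ 2 hε.le ?_
        nlinarith [sq_nonneg ‖((u k : Lp ℝ 2 (closureMeasure Γ))) - u l‖]
      · refine lt_of_pow_lt_pow_left₀ 2 hε.le ?_
        nlinarith [sq_nonneg ‖g k - g l‖, sq_nonneg ε]
    obtain ⟨G, hG⟩ := cauchySeq_tendsto_of_complete (u := g) (Metric.cauchySeq_iff.2
      fun ε hε => by
        obtain ⟨N, hN⟩ := hcau ε hε
        exact ⟨N, fun k hk l hl => by rw [dist_eq_norm]; exact (hN k hk l hl).1⟩)
    obtain ⟨V, hV⟩ := cauchySeq_tendsto_of_complete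
      (u := fun k => (u k : Lp ℝ 2 (closureMeasure Γ))) (Metric.cauchySeq_iff.2
      fun ε hε => by
        obtain ⟨N, hN⟩ := hcau ε hε
        exact ⟨N, fun k hk l hl => by rw [dist_eq_norm]; exact (hN k hk l hl).2⟩)
    have hVG : (V, G) ∈ W :=
      hWc.mem_of_tendsto (hV.prodMk_nhds hG) (Eventually.of_forall hg)
    refine ⟨⟨V, (hdom V).2 ⟨G, hVG⟩⟩, ?_⟩
    have : ∀ k, Q.formOne (u k - ⟨V, (hdom V).2 ⟨G, hVG⟩⟩) (u k - ⟨V, (hdom V).2 ⟨G, hVG⟩⟩)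
        = (1 / 2) * ‖g k - G‖ ^ 2 + ‖(u k : Lp ℝ 2 (closureMeasure Γ)) - V‖ ^ 2 := fun k =>
      hone (u k) ⟨V, (hdom V).2 ⟨G, hVG⟩⟩ (g k) G (hg k) hVG
    simp only [this]
    have l1 := ((tendsto_iff_norm_sub_tendsto_zero.1 hG).pow 2).const_mul (1 / 2 : ℝ)
    have l2 := (tendsto_iff_norm_sub_tendsto_zero.1 hV).pow 2
    simpa using l1.add l2
  · intro u
    obtain ⟨g, hg⟩ := hgrad u
    obtain ⟨h, hh, hle⟩ := exists_unitContraction_mem_closure hΓ hK hKi hg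
    refine ⟨⟨unitContraction (u : Lp ℝ 2 (closureMeasure Γ)), (hdom _).2 ⟨h, hh⟩⟩,
      coeFn_unitContraction _, ?_⟩
    rw [hself u g hg, hself ⟨unitContraction (u : Lp ℝ 2 (closureMeasure Γ)), _⟩ h hh]
    simp only at hle
    gcongr
  · intro u ε hε
    obtain ⟨g, hg⟩ := hgrad u
    -- This gives `η ^ 2 ≤ ε / 2`, so half of it plus all of it stays below `ε`.
    set η := min 1 (ε / 2) with hη
    have hη0 : 0 < η := by positivity
    obtain ⟨p, hpD, hp⟩ := Metric.mem_closure_iff.1 hg η hη0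
    rw [Prod.dist_eq, max_lt_iff, dist_eq_norm, dist_eq_norm] at hp
    obtain ⟨f, hf, hc, hp1, -⟩ := id hpD
    have hpW : (p.1, p.2) ∈ W := Submodule.le_topologicalClosure _ hpD
    refine ⟨⟨p.1, (hdom _).2 ⟨p.2, hpW⟩⟩,
      ⟨_, (hcont f hf hc).1, (hcont f hf hc).2, hp1⟩, ?_⟩
    rw [hone u ⟨p.1, _⟩ g p.2 hg hpW]
    have h1 : ‖g - p.2‖ ^ 2 < η ^ 2 := by
      have := hp.2
      gcongr
    have h2 : ‖(u : Lp ℝ 2 (closureMeasure Γ)) - p.1‖ ^ 2 < η ^ 2 := by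
      have := hp.1
      gcongr
    have h3 : η ^ 2 ≤ ε / 2 := by
      have : η ≤ 1 := min_le_left _ _
      have : η ≤ ε / 2 := min_le_right _ _
      nlinarith
    simp only
    linarith
  · intro f hf hc ε hε
    obtain ⟨h, hh, hhc, hhf⟩ := hc.exists_extension isClosed_closure hf
    obtain ⟨k, hk, -, happ⟩ := hhc.exists_abs_sub_comp_collapse_lt hK hKi j hh
    obtain ⟨g, hg, hgc, -, hgh⟩ := happ ε hε
    obtain ⟨p, hpD, hp1, -⟩ := exists_mem_collapsedGraph Γ hK hKi j hg hgc
    refine ⟨_, (hcont g hg hgc).1, (hcont g hg hgc).2,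
      ⟨⟨p.1, (hdom _).2 ⟨p.2, Submodule.le_topologicalClosure _ hpD⟩⟩, hp1⟩, fun x => ?_⟩
    rw [← hhf]
    exact hgh x

end Regular

end

/-! ### Properness: a slab of positive measure -/

noncomputable section

section Proper

variable {d : ℕ}

/-- Every interval contains a compact set without interior points and of positive measure. -/
theorem exists_isCompact_interior_eq_empty_measure_inter_ball_pos (a : ℝ) {s : ℝ} (hs : 0 < s) :
    ∃ K : Set ℝ, IsCompact K ∧ interior K = ∅ ∧ 0 < volume (K ∩ Metric.ball a s) := by
  have hQ : volume (Set.range ((↑) : ℚ → ℝ)) < ENNReal.ofReal (2 * s) := by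
    rw [(Set.countable_range _).measure_zero]
    simpa using hs
  -- Remove from the interval an open neighbourhood of the rationals of smaller measure: what
  -- remains has positive measure and contains no rational.
  obtain ⟨U, hQU, hU, hUs⟩ := Set.exists_isOpen_lt_of_lt _ _ hQ
  refine ⟨Metric.closedBall a s \ U, (isCompact_closedBall a s).diff hU, ?_, ?_⟩
  · by_contra hne
    obtain ⟨q, hq⟩ := Rat.denseRange_cast.exists_mem_open isOpen_interior
      (Set.nonempty_iff_ne_empty.2 hne)
    exact (interior_subset hq).2 (hQU ⟨q, rfl⟩)
  · have h1 : volume (Metric.ball a s) - volume U ≤ volume (Metric.ball a s \ U) :=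
      le_measure_sdiff
    rw [Real.volume_ball] at h1
    refine ((tsub_pos_of_lt hUs).trans_le h1).trans_le (measure_mono fun x hx => ?_)
    exact ⟨⟨Metric.ball_subset_closedBall hx.1, hx.2⟩, hx.1⟩

/-- An open set contains a cube in product coordinates. Intersecting its `j`-th side with a suitable
`K` leaves a product of sets of positive measure. -/
theorem exists_isCompact_measure_slab_pos {V : Set (EuclideanSpace ℝ (Fin d))} (hV : IsOpen V)
    (hne : V.Nonempty) (j : Fin d) : ∃ K : Set ℝ, IsCompact K ∧ interior K = ∅ ∧
      0 < volume (V ∩ {x | x j ∈ K}) := by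
  obtain ⟨c, hc⟩ := hne
  have hV' : IsOpen ((WithLp.toLp 2 : (Fin d → ℝ) → EuclideanSpace ℝ (Fin d)) ⁻¹' V) :=
    hV.preimage (PiLp.continuous_toLp 2 _)
  obtain ⟨s, hs, hsV⟩ := Metric.isOpen_iff.1 hV' (WithLp.ofLp c) hc
  obtain ⟨K, hK, hKi, hKs⟩ := exists_isCompact_interior_eq_empty_measure_inter_ball_pos (c j) hs
  refine ⟨K, hK, hKi, ?_⟩
  set A : Set (Fin d → ℝ) := Set.pi Set.univ
    fun i => if i = j then K ∩ Metric.ball (c i) s else Metric.ball (c i) s with hA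
  have hApos : 0 < volume A := by
    rw [hA, volume_pi_pi]
    refine CanonicallyOrderedAdd.prod_pos.2 fun i _ => ?_
    by_cases hi : i = j
    · subst hi
      simpa using hKs
    · simpa [hi, Real.volume_ball] using hs
  have hAm : MeasurableSet A := MeasurableSet.univ_pi fun i => by
    split_ifs
    · exact hK.measurableSet.inter measurableSet_ball
    · exact measurableSet_ball
  rw [← (PiLp.volume_preserving_ofLp (Fin d)).measure_preimage
    hAm.nullMeasurableSet] at hApos
  refine hApos.trans_le (measure_mono fun x hx => ?_)
  have hx' : ∀ i, x i ∈ if i = j then K ∩ Metric.ball (c i) s else Metric.ball (c i) s :=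
    fun i => hx i (Set.mem_univ i)
  refine ⟨?_, ?_⟩
  · have : WithLp.ofLp x ∈ Metric.ball (WithLp.ofLp c) s := by
      rw [ball_pi _ hs]
      intro i _
      have := hx' i
      split_ifs at this
      · exact this.2
      · exact this
    exact hsV this
  · have := hx' j
    rw [if_pos rfl] at this
    exact this.1

/-- For a suitable `K` the functions that are constant across the slab over `K` do not exhaust the
smooth functions. -/
theorem exists_mem_collapsedGraph_empty_notMem_closure {Γ : Set (EuclideanSpace ℝ (Fin d))}
    (hΓ : IsOpen Γ) (hne : Γ.Nonempty) (j : Fin d) :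
    ∃ K : Set ℝ, IsCompact K ∧ interior K = ∅ ∧
      ∃ p ∈ collapsedGraph Γ ∅ j, p ∉ (collapsedGraph Γ K j).topologicalClosure := by
  obtain ⟨c, hc⟩ := hne
  obtain ⟨K, hK, hKi, hpos⟩ := exists_isCompact_measure_slab_pos (hΓ.inter Metric.isOpen_ball)
    ⟨c, hc, Metric.mem_ball_self one_pos⟩ j
  refine ⟨K, hK, hKi, ?_⟩
  set B : Set (EuclideanSpace ℝ (Fin d)) := Γ ∩ Metric.ball c 1 ∩ {x | x j ∈ K} with hB
  have hBΓ : B ⊆ Γ := fun x hx => hx.1.1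
  have hBm : MeasurableSet B :=
    (hΓ.inter Metric.isOpen_ball).measurableSet.inter
      ((by fun_prop : Continuous fun x : EuclideanSpace ℝ (Fin d) => x j).measurable
        hK.measurableSet)
  have hBt : volume B ≠ ⊤ := ne_top_of_le_ne_top (measure_ball_lt_top (x := c) (r := 1)).ne
    (measure_mono fun x hx => hx.1.2)
  have hBt' : (volume.restrict Γ) B ≠ ⊤ :=
    ne_top_of_le_ne_top hBt (Measure.restrict_le_self B)
  set e : EuclideanSpace ℝ (Fin d) := EuclideanSpace.single j 1 with he
  -- The separating functional is the integral of the `j`-th derivative over the part `B` of the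
  -- slab; as an inner product it is continuous, so vanishing on the core passes to the closure.
  have hℓ : ∀ g : Lp (EuclideanSpace ℝ (Fin d)) 2 (volume.restrict Γ),
      inner ℝ (indicatorConstLp 2 hBm hBt' e) g = ∫ x in B, g x j := by
    intro g
    rw [L2.inner_indicatorConstLp_eq_setIntegral_inner,
      Measure.restrict_restrict_of_subset hBΓ]
    simp [he, EuclideanSpace.inner_single_left]
  have hzero : ∀ p ∈ (collapsedGraph Γ K j).topologicalClosure,
      inner ℝ (indicatorConstLp 2 hBm hBt' e) p.2 = (0 : ℝ) := by
    have hcl : IsClosed {p : Lp ℝ 2 (closureMeasure Γ) ×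
        Lp (EuclideanSpace ℝ (Fin d)) 2 (volume.restrict Γ) |
        inner ℝ (indicatorConstLp 2 hBm hBt' e) p.2 = (0 : ℝ)} :=
      isClosed_eq (by fun_prop) continuous_const
    refine fun p hp => closure_minimal ?_ hcl hp
    rintro ⟨u, g⟩ ⟨f, hf, hfc, hu, hg⟩
    have hg' : ∀ᵐ x ∂(volume.restrict B), g x = collapseGradient K j f x :=
      ae_mono (Measure.restrict_mono hBΓ le_rfl) hg
    change inner ℝ (indicatorConstLp 2 hBm hBt' e) g = (0 : ℝ)
    rw [hℓ]
    refine integral_eq_zero_of_ae ?_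
    filter_upwards [hg', ae_restrict_mem hBm] with x hx hxB
    have hxK : x j ∈ K := hxB.2
    rw [hx, collapseGradient_apply, collapseDir_single_of_mem j hxK, map_zero]
    rfl
  -- The bump is `1` on the unit ball around `c`, which contains `B`. There the `j`-th derivative of
  -- `b x * x j` is `1`, so the functional takes the value `|B| > 0`.
  let b : ContDiffBump c := ⟨1, 2, one_pos, one_lt_two⟩
  have hproj : ContDiff ℝ ∞ fun x : EuclideanSpace ℝ (Fin d) => x j :=
    (EuclideanSpace.proj (𝕜 := ℝ) j).contDiff
  obtain ⟨p, hpD, -, hp2⟩ := exists_mem_collapsedGraph Γ isCompact_empty interior_empty j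
    (f := fun x => b x * x j) (b.contDiff.mul hproj) b.hasCompactSupport.mul_right
  refine ⟨p, hpD, fun hp => ?_⟩
  have h0 := hzero p hp
  have hp2' : ∀ᵐ x ∂(volume.restrict B),
      p.2 x = collapseGradient ∅ j (fun x => b x * x j) x :=
    ae_mono (Measure.restrict_mono hBΓ le_rfl) hp2
  have h1 : ∫ x in B, p.2 x j = ∫ x in B, (1 : ℝ) := by
    refine integral_congr_ae ?_
    filter_upwards [hp2', ae_restrict_mem hBm] with x hx hxB
    rw [hx, collapseGradient_apply, collapseDir_empty, collapse_empty, id]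
    have hev : (fun x => b x * x j) =ᶠ[𝓝 x] fun x : EuclideanSpace ℝ (Fin d) => x j := by
      filter_upwards [Metric.isOpen_ball.mem_nhds hxB.1.2] with y hy
      rw [b.one_of_mem_closedBall (Metric.ball_subset_closedBall hy), one_mul]
    have hfd : fderiv ℝ (fun x : EuclideanSpace ℝ (Fin d) => x j) x
        = EuclideanSpace.proj (𝕜 := ℝ) j := (EuclideanSpace.proj (𝕜 := ℝ) j).fderiv
    rw [hev.fderiv_eq, hfd]
    simp
  rw [hℓ, h1, setIntegral_const, smul_eq_mul, mul_one] at h0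
  exact (ENNReal.toReal_pos hpos.ne' hBt).ne' h0

end Proper

end

/-! ### Geometry of continuous boundaries and inward shifts -/

noncomputable section

section Boundary

/-- Near a boundary point a domain with continuous boundary is the positivity set of a continuous
function that grows at unit speed in some direction. -/
theorem HasContinuousBoundary.exists_continuous {n : ℕ}
    {Γ : Set (EuclideanSpace ℝ (Fin (n + 1)))} (h : HasContinuousBoundary Γ)
    {x : EuclideanSpace ℝ (Fin (n + 1))} (hx : x ∈ frontier Γ) :
    ∃ U ∈ 𝓝 x, ∃ (Φ : EuclideanSpace ℝ (Fin (n + 1)) → ℝ) (w : EuclideanSpace ℝ (Fin (n + 1))),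
      Continuous Φ ∧ (∀ y, ∀ t : ℝ, Φ (y + t • w) = Φ y + t) ∧ Γ ∩ U = {y | 0 < Φ y} ∩ U := by
  obtain ⟨U, hU, e, F, hF, hΓU⟩ := h x hx
  refine ⟨U, hU, fun y => e y (Fin.last n) - F fun i => e y i.castSucc,
    e.linearIsometryEquiv.symm (EuclideanSpace.single (Fin.last n) 1), ?_, fun y t => ?_, ?_⟩
  · have := e.continuous
    fun_prop
  · have he : e (y + t • e.linearIsometryEquiv.symm (EuclideanSpace.single (Fin.last n) 1))
        = e y + t • EuclideanSpace.single (Fin.last n) 1 := by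
      have h1 := e.map_vadd y
        (t • e.linearIsometryEquiv.symm (EuclideanSpace.single (Fin.last n) 1))
      rw [map_smul, LinearIsometryEquiv.apply_symm_apply, vadd_eq_add, vadd_eq_add,
        add_comm _ y, add_comm _ (e y)] at h1
      exact h1
    have hlast : ∀ i : Fin n, i.castSucc ≠ Fin.last n := fun i => (Fin.castSucc_lt_last i).ne
    simp only [he]
    simp [hlast]
    ring
  · rw [hΓU]
    ext y
    simp [sub_pos]

variable {E : Type*} [NormedAddCommGroup E]

/-- The level sets of a function that grows at unit speed in some direction are null sets. -/
theorem measure_setOf_eq_zero_of_forall_add_smul [NormedSpace ℝ E] [MeasurableSpace E] [BorelSpace E]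
    {μ : Measure E} [SFinite μ] [μ.IsAddRightInvariant] {Φ : E → ℝ} {w : E}
    (hΦ : Continuous Φ) (hw : ∀ y, ∀ t : ℝ, Φ (y + t • w) = Φ y + t) : μ {y | Φ y = 0} = 0 := by
  by_contra hne
  -- The level sets are disjoint and translates of one another. If one had positive measure,
  -- uncountably many would, which is impossible for an s-finite measure.
  have hc := Measure.countable_meas_pos_of_disjoint_iUnion (μ := μ) (As := fun t : ℝ => {y | Φ y = t})
    (fun t => (isClosed_eq hΦ continuous_const).measurableSet) (by
      intro s t hst
      rw [Function.onFun, Set.disjoint_left]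
      rintro y rfl rfl
      exact hst rfl)
  have hall : {t : ℝ | 0 < μ {y | Φ y = t}} = Set.univ := by
    refine Set.eq_univ_of_forall fun t => ?_
    have hpre : (fun y => y + t • w) ⁻¹' {y | Φ y = t} = {y | Φ y = 0} := by
      ext y
      simp [hw]
    have := measure_preimage_add_right μ (t • w) {y | Φ y = t}
    rw [hpre] at this
    change 0 < μ {y | Φ y = t}
    rw [← this]
    exact pos_iff_ne_zero.2 hne
  rw [hall] at hc
  exact Cardinal.not_countable_real hc

/-- Locally the frontier lies in the null set `Φ = 0`: a frontier point is not in the open set `Γ`,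
so `Φ ≤ 0`, and `Φ < 0` would give it a neighbourhood disjoint from `Γ`. -/
theorem HasContinuousBoundary.measure_frontier {n : ℕ}
    {Γ : Set (EuclideanSpace ℝ (Fin (n + 1)))} (h : HasContinuousBoundary Γ) (hΓ : IsOpen Γ) :
    volume (frontier Γ) = 0 := by
  refine measure_null_of_locally_null _ fun x hx => ?_
  obtain ⟨U, hU, Φ, w, hΦ, hw, hΓU⟩ := h.exists_continuous hx
  refine ⟨frontier Γ ∩ interior U,
    inter_mem_nhdsWithin _ (isOpen_interior.mem_nhds (mem_interior_iff_mem_nhds.2 hU)),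
    measure_mono_null (fun y hy => ?_) (measure_setOf_eq_zero_of_forall_add_smul hΦ hw)⟩
  have hyU : y ∈ U := interior_subset hy.2
  have hiff : ∀ z ∈ U, z ∈ Γ ↔ 0 < Φ z := fun z hz =>
    ⟨fun h => (hΓU.subset ⟨h, hz⟩).1, fun h => (hΓU.superset ⟨h, hz⟩).1⟩
  have hyΓ : y ∉ Γ := by
    have := hy.1.2
    rwa [hΓ.interior_eq] at this
  have hle : Φ y ≤ 0 := not_lt.1 fun hlt => hyΓ ((hiff y hyU).2 hlt)
  by_contra hne
  have hlt : Φ y < 0 := lt_of_le_of_ne hle hne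
  have hopen : IsOpen (interior U ∩ {z | Φ z < 0}) :=
    isOpen_interior.inter (isOpen_lt hΦ continuous_const)
  obtain ⟨z, ⟨hzU, hz0⟩, hzΓ⟩ := mem_closure_iff.1 hy.1.1 _ hopen ⟨hy.2, hlt⟩
  exact lt_asymm hz0 ((hiff z (interior_subset hzU)).1 hzΓ)

/-- There are arbitrarily small translations, stable under perturbations, that move the part of `k`
near `Γ` only to points whose preimages in `k` lie in `Γ`. -/
def AdmitsInwardShifts (Γ k : Set E) : Prop :=
  ∀ ε > 0, ∃ b : E, ‖b‖ < ε ∧ ∃ δ > 0, ∀ x ∈ Γ, ∀ y ∈ Metric.ball b δ, x - y ∈ k → x - y ∈ Γ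

theorem admitsInwardShifts_of_subset {Γ k : Set E} (h : k ⊆ Γ) : AdmitsInwardShifts Γ k :=
  fun ε hε => ⟨0, by simpa using hε, 1, one_pos, fun _ _ _ _ hk => h hk⟩

/-- The set `k` has positive distance from the closure of `Γ`, so for `b = 0` and small `δ` no point
of `Γ` is moved into `k`. -/
theorem admitsInwardShifts_of_disjoint {Γ k : Set E} (hk : IsCompact k) (h : k ⊆ (closure Γ)ᶜ) :
    AdmitsInwardShifts Γ k := by
  intro ε hε
  obtain ⟨δ, hδ, hδΓ⟩ := hk.exists_thickening_subset_open isClosed_closure.isOpen_compl h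
  refine ⟨0, by simpa using hε, δ, hδ, fun x hx y hy hxy => ?_⟩
  refine absurd (subset_closure hx) (hδΓ (Metric.mem_thickening_iff.2 ⟨x - y, hxy, ?_⟩))
  simpa [dist_eq_norm] using hy

/-- Take `b = -(t • w)`. Subtracting `b` raises `Φ` by exactly `t`, and by uniform continuity a
further small perturbation changes `Φ` by less than `t`, so `Φ` stays positive. -/
theorem admitsInwardShifts_of_forall_add_smul [NormedSpace ℝ E] [ProperSpace E] {Γ U k : Set E} (hk : IsCompact k)
    (hkU : k ⊆ interior U) {Φ : E → ℝ} {w : E} (hΦ : Continuous Φ)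
    (hw : ∀ y, ∀ t : ℝ, Φ (y + t • w) = Φ y + t) (hΓU : Γ ∩ U = {y | 0 < Φ y} ∩ U) :
    AdmitsInwardShifts Γ k := by
  intro ε hε
  obtain ⟨r, hr, hrU⟩ := hk.exists_thickening_subset_open isOpen_interior hkU
  obtain ⟨t, ht, htε⟩ : ∃ t : ℝ, 0 < t ∧ ‖t • w‖ < min ε (r / 2) := by
    have hlim : Tendsto (fun t : ℝ => ‖t • w‖) (𝓝[>] 0) (𝓝 0) := by
      have : Continuous fun t : ℝ => ‖t • w‖ := by fun_prop
      simpa using (this.tendsto 0).mono_left (nhdsWithin_le_nhds (s := Set.Ioi 0))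
    obtain ⟨t, h1, h2⟩ := ((hlim.eventually_lt_const (by positivity : 0 < min ε (r / 2))).and
      self_mem_nhdsWithin).exists
    exact ⟨t, h2, h1⟩
  -- The point `x + t • w` is only close to `k`, so uniform continuity is needed on a compact
  -- neighbourhood of `k`.
  have hk1 : IsCompact (Metric.cthickening 1 k) := hk.cthickening
  obtain ⟨η, hη, hηΦ⟩ := Metric.uniformContinuousOn_iff.1
    (hk1.uniformContinuousOn_of_continuous hΦ.continuousOn) t ht
  refine ⟨-(t • w), ?_, min (min η 1) (r / 2), by positivity, fun x hx y hy hxy => ?_⟩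
  · rw [norm_neg]
    exact htε.trans_le (min_le_left _ _)
  · rw [Metric.mem_ball, dist_eq_norm, sub_neg_eq_add, lt_min_iff, lt_min_iff] at hy
    have hxU : x ∈ U := by
      refine interior_subset (hrU (Metric.mem_thickening_iff.2 ⟨x - y, hxy, ?_⟩))
      rw [dist_eq_norm, sub_sub_cancel]
      calc ‖y‖ = ‖(y + t • w) - t • w‖ := by rw [add_sub_cancel_right]
        _ ≤ ‖y + t • w‖ + ‖t • w‖ := norm_sub_le _ _
        _ < r := by linarith [hy.2, htε.trans_le (min_le_right ε (r / 2))]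
    have hx0 : 0 < Φ x := (hΓU.subset ⟨hx, hxU⟩).1
    have hxw : Φ (x + t • w) = Φ x + t := hw x t
    have hd : dist (x + t • w) (x - y) = ‖y + t • w‖ := by
      rw [dist_eq_norm]
      congr 1
      abel
    have hmem : x - y ∈ Metric.cthickening 1 k := Metric.self_subset_cthickening k hxy
    have hmem' : x + t • w ∈ Metric.cthickening 1 k :=
      Metric.mem_cthickening_of_dist_le _ (x - y) 1 _ hxy (hd ▸ hy.1.2.le)
    have hlt := hηΦ _ hmem' _ hmem (by rw [hd]; exact hy.1.1)
    rw [Real.dist_eq, abs_lt] at hlt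
    have hpos : 0 < Φ (x - y) := by linarith [hlt.2]
    exact (hΓU.superset ⟨hpos, interior_subset (hkU hxy)⟩).1

/-- Every point has a neighbourhood whose compact subsets admit inward shifts. -/
theorem HasContinuousBoundary.exists_isOpen_forall_admitsInwardShifts {n : ℕ}
    {Γ : Set (EuclideanSpace ℝ (Fin (n + 1)))} (h : HasContinuousBoundary Γ) (hΓ : IsOpen Γ)
    (x : EuclideanSpace ℝ (Fin (n + 1))) :
    ∃ O, IsOpen O ∧ x ∈ O ∧ ∀ k ⊆ O, IsCompact k → AdmitsInwardShifts Γ k := by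
  by_cases hx : x ∈ Γ
  · exact ⟨Γ, hΓ, hx, fun k hk _ => admitsInwardShifts_of_subset hk⟩
  by_cases hx' : x ∈ closure Γ
  · obtain ⟨U, hU, Φ, w, hΦ, hw, hΓU⟩ := h.exists_continuous
      ⟨hx', by rwa [hΓ.interior_eq]⟩
    exact ⟨interior U, isOpen_interior, mem_interior_iff_mem_nhds.2 hU, fun k hk hkc =>
      admitsInwardShifts_of_forall_add_smul hkc hk hΦ hw hΓU⟩
  · exact ⟨(closure Γ)ᶜ, isClosed_closure.isOpen_compl, hx', fun k hk hkc =>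
      admitsInwardShifts_of_disjoint hkc hk⟩

end Boundary

end

/-! ### Mollification along inward shifts -/

noncomputable section

section Mollified

variable {d : ℕ}

theorem MeasureTheory.MemLp.integrable_mul_of_hasCompactSupport
    {μ : Measure (EuclideanSpace ℝ (Fin d))} [IsFiniteMeasureOnCompacts μ]
    {U f : EuclideanSpace ℝ (Fin d) → ℝ} (hU : MemLp U 2 μ) (hf : Continuous f)
    (hc : HasCompactSupport f) : Integrable (fun x => U x * f x) μ :=
  hU.integrable_mul (q := 2) (hf.memLp_of_hasCompactSupport hc)

theorem memLp_coord {Γ : Set (EuclideanSpace ℝ (Fin d))}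
    (g : Lp (EuclideanSpace ℝ (Fin d)) 2 (volume.restrict Γ)) (i : Fin d) :
    MemLp (fun x => g x i) 2 (volume.restrict Γ) :=
  (EuclideanSpace.proj (𝕜 := ℝ) i).comp_memLp' (Lp.memLp g)

/-- The product rule for weak gradients. -/
theorem IsWeakGradient.setIntegral_mul {Γ : Set (EuclideanSpace ℝ (Fin d))}
    {u : Lp ℝ 2 (closureMeasure Γ)} {g : Lp (EuclideanSpace ℝ (Fin d)) 2 (volume.restrict Γ)}
    (hug : IsWeakGradient Γ u g) {U : EuclideanSpace ℝ (Fin d) → ℝ} (hUL : MemLp U 2)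
    (hU : ∀ y : closure Γ, u y = U y) {ζ ψ : EuclideanSpace ℝ (Fin d) → ℝ} (hζ : ContDiff ℝ ∞ ζ)
    (hζc : HasCompactSupport ζ) (hψ : ContDiff ℝ ∞ ψ) (hs : tsupport (fun x => ζ x * ψ x) ⊆ Γ)
    (i : Fin d) :
    ∫ x in Γ, ζ x * U x * fderiv ℝ ψ x (EuclideanSpace.single i 1)
      = - ∫ x in Γ, (ζ x * g x i + U x * fderiv ℝ ζ x (EuclideanSpace.single i 1)) * ψ x := by
  set e : EuclideanSpace ℝ (Fin d) := EuclideanSpace.single i 1 with he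
  have hU' : MemLp U 2 (volume.restrict Γ) := hUL.restrict Γ
  have hd : ∀ {f : EuclideanSpace ℝ (Fin d) → ℝ}, ContDiff ℝ ∞ f →
      Continuous fun x => fderiv ℝ f x e := fun hf => by
    have := hf.continuous_fderiv (by simp)
    fun_prop
  have hfd : ∀ x, fderiv ℝ (fun x => ζ x * ψ x) x e
      = ζ x * fderiv ℝ ψ x e + ψ x * fderiv ℝ ζ x e := fun x => by
    rw [fderiv_fun_mul (hζ.differentiable (by simp) x) (hψ.differentiable (by simp) x)]
    simp
  -- Only the product `ζ ψ` has to be a test function on `Γ`; `ψ` itself may reach across the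
  -- boundary.
  have h := hug (fun x => ζ x * ψ x) (hζ.mul hψ) hζc.mul_right hs i
  simp only [hU] at h
  rw [setIntegral_closureMeasure (fun x => U x * fderiv ℝ (fun x => ζ x * ψ x) x e)] at h
  simp only [hfd] at h
  have i1 : Integrable (fun x => U x * (ζ x * fderiv ℝ ψ x e)) (volume.restrict Γ) :=
    hU'.integrable_mul_of_hasCompactSupport (hζ.continuous.mul (hd hψ)) hζc.mul_right
  have i2 : Integrable (fun x => U x * (ψ x * fderiv ℝ ζ x e)) (volume.restrict Γ) :=
    hU'.integrable_mul_of_hasCompactSupport (hψ.continuous.mul (hd hζ))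
      (hζc.fderiv_apply (𝕜 := ℝ) e).mul_left
  have i3 : Integrable (fun x => g x i * (ζ x * ψ x)) (volume.restrict Γ) :=
    (memLp_coord g i).integrable_mul_of_hasCompactSupport (hζ.continuous.mul hψ.continuous)
      hζc.mul_right
  simp only [mul_add] at h
  rw [integral_add i1 i2] at h
  have e1 : ∫ x in Γ, ζ x * U x * fderiv ℝ ψ x e = ∫ x in Γ, U x * (ζ x * fderiv ℝ ψ x e) := by
    congr 1
    ext x
    ring
  have e2 : ∫ x in Γ, (ζ x * g x i + U x * fderiv ℝ ζ x e) * ψ x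
      = (∫ x in Γ, g x i * (ζ x * ψ x)) + ∫ x in Γ, U x * (ψ x * fderiv ℝ ζ x e) := by
    rw [← integral_add i3 i2]
    congr 1
    ext x
    ring
  rw [e1, e2]
  linarith

/-- If `b` is an inward shift, then mollifying with a bump centred at `b` commutes with the weak
gradient on `Γ`. -/
theorem IsWeakGradient.fderiv_normed_convolution {Γ : Set (EuclideanSpace ℝ (Fin d))}
    (hΓ : IsOpen Γ) {u : Lp ℝ 2 (closureMeasure Γ)}
    {g : Lp (EuclideanSpace ℝ (Fin d)) 2 (volume.restrict Γ)}
    (hug : IsWeakGradient Γ u g) {U : EuclideanSpace ℝ (Fin d) → ℝ} (hUL : MemLp U 2)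
    (hU : ∀ y : closure Γ, u y = U y) {ζ : EuclideanSpace ℝ (Fin d) → ℝ} (hζ : ContDiff ℝ ∞ ζ)
    (hζc : HasCompactSupport ζ) {b : EuclideanSpace ℝ (Fin d)} (φ : ContDiffBump b)
    {x : EuclideanSpace ℝ (Fin d)}
    (hx : ∀ y ∈ Metric.closedBall b φ.rOut, x - y ∈ tsupport ζ → x - y ∈ Γ) (i : Fin d)
    (hVL : LocallyIntegrable (Γ.indicator fun x => ζ x * U x)) :
    fderiv ℝ (convolution (φ.normed volume) (Γ.indicator fun x => ζ x * U x)
        (ContinuousLinearMap.lsmul ℝ ℝ) volume) x (EuclideanSpace.single i 1)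
      = convolution (φ.normed volume)
        (Γ.indicator fun x => ζ x * g x i + U x * fderiv ℝ ζ x (EuclideanSpace.single i 1))
        (ContinuousLinearMap.lsmul ℝ ℝ) volume x := by
  set e : EuclideanSpace ℝ (Fin d) := EuclideanSpace.single i 1 with he
  set V := Γ.indicator fun x => ζ x * U x with hV
  set H := Γ.indicator fun x => ζ x * g x i + U x * fderiv ℝ ζ x e with hH
  set ρ := φ.normed volume with hρ
  have hρs : ContDiff ℝ ∞ ρ := φ.contDiff_normed
  have hρc : HasCompactSupport ρ := φ.hasCompactSupport_normed
  set L := ContinuousLinearMap.lsmul ℝ ℝ (E := ℝ) with hL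
  set ψ : EuclideanSpace ℝ (Fin d) → ℝ := fun z => ρ (x - z) with hψ
  have hψs : ContDiff ℝ ∞ ψ := hρs.comp (contDiff_const.sub contDiff_id)
  have hψd : ∀ z, fderiv ℝ ψ z e = - fderiv ℝ ρ (x - z) e := by
    intro z
    have h1 : HasFDerivAt (fun z => x - z)
        (-ContinuousLinearMap.id ℝ (EuclideanSpace ℝ (Fin d))) z := (hasFDerivAt_id z).const_sub x
    have h2 : HasFDerivAt ψ ((fderiv ℝ ρ (x - z)).comp
        (-ContinuousLinearMap.id ℝ (EuclideanSpace ℝ (Fin d)))) z :=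
      ((hρs.differentiable (by simp)) (x - z)).hasFDerivAt.comp z h1
    rw [h2.fderiv]
    simp
  -- The shift condition enters here: a point in the supports of both `ζ` and the reflected bump `ψ`
  -- lies in `Γ`, although the bump may leave `Γ`.
  have hs : tsupport (fun z => ζ z * ψ z) ⊆ Γ := by
    intro z hz
    have hz1 : z ∈ tsupport ζ := tsupport_mul_subset_left hz
    have hz2 : z ∈ tsupport ψ := tsupport_mul_subset_right hz
    have hz3 : x - z ∈ tsupport ρ := by
      have hsub : tsupport ψ ⊆ (fun z => x - z) ⁻¹' tsupport ρ :=
        closure_minimal (fun y hy => subset_tsupport ρ hy)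
          ((isClosed_tsupport ρ).preimage (continuous_const.sub continuous_id))
      exact hsub hz2
    rw [hρ, φ.tsupport_normed_eq] at hz3
    have := hx (x - z) hz3
    rw [sub_sub_cancel] at this
    exact this hz1
  have hkey := hug.setIntegral_mul hUL hU hζ hζc hψs hs i
  have hconv := hρc.hasFDerivAt_convolution_left (L := L) (μ := volume) (g := V)
    (hρs.of_le (by simp)) hVL x
  have hex : ConvolutionExists (fderiv ℝ ρ) V (L.precompL (EuclideanSpace ℝ (Fin d))) volume :=
    (hρc.fderiv (𝕜 := ℝ)).convolutionExists_left _ (hρs.continuous_fderiv (by simp)) hVL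
  have hL' : ∀ (A : EuclideanSpace ℝ (Fin d) →L[ℝ] ℝ) (c : ℝ),
      (L.precompL (EuclideanSpace ℝ (Fin d)) A c) e = A e * c := fun A c => rfl
  rw [hconv.fderiv, convolution_def, ContinuousLinearMap.integral_apply (hex x)]
  simp only [hL']
  calc ∫ t, fderiv ℝ ρ t e * V (x - t)
      = ∫ z, fderiv ℝ ρ (x - z) e * V (x - (x - z)) :=
        (integral_sub_left_eq_self (fun t => fderiv ℝ ρ t e * V (x - t)) volume x).symm
    _ = - ∫ z in Γ, ζ z * U z * fderiv ℝ ψ z e := by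
        rw [← integral_indicator hΓ.measurableSet, ← integral_neg]
        refine integral_congr_ae (Eventually.of_forall fun z => ?_)
        simp only [sub_sub_cancel, hV]
        by_cases hz : z ∈ Γ
        · simp only [Set.indicator_of_mem hz, hψd]
          ring
        · simp [Set.indicator_of_notMem hz]
    _ = ∫ z in Γ, (ζ z * g z i + U z * fderiv ℝ ζ z e) * ψ z := by rw [hkey, neg_neg]
    _ = ∫ z, ρ (x - z) * H (x - (x - z)) := by
        rw [← integral_indicator hΓ.measurableSet]
        refine integral_congr_ae (Eventually.of_forall fun z => ?_)
        simp only [sub_sub_cancel, hH]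
        by_cases hz : z ∈ Γ
        · simp only [Set.indicator_of_mem hz, hψ]
          ring
        · simp [Set.indicator_of_notMem hz]
    _ = ∫ t, ρ t * H (x - t) :=
        integral_sub_left_eq_self (fun t => ρ t * H (x - t)) volume x
    _ = _ := rfl

/-- The first component of the closure of the smooth graph. -/
def IsSmoothLimit (Γ : Set (EuclideanSpace ℝ (Fin d))) (j : Fin d)
    (V : EuclideanSpace ℝ (Fin d) → ℝ) : Prop :=
  ∃ p ∈ (collapsedGraph Γ ∅ j).topologicalClosure, p.1 =ᵐ[closureMeasure Γ] fun y => V y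

theorem IsSmoothLimit.add {Γ : Set (EuclideanSpace ℝ (Fin d))} {j : Fin d}
    {V W : EuclideanSpace ℝ (Fin d) → ℝ} (hV : IsSmoothLimit Γ j V) (hW : IsSmoothLimit Γ j W) :
    IsSmoothLimit Γ j (V + W) := by
  obtain ⟨p, hp, hpV⟩ := hV
  obtain ⟨q, hq, hqW⟩ := hW
  refine ⟨p + q, Submodule.add_mem _ hp hq, ?_⟩
  filter_upwards [Lp.coeFn_add p.1 q.1, hpV, hqW] with y h1 h2 h3
  rw [Prod.fst_add, h1, Pi.add_apply, h2, h3, Pi.add_apply]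

theorem isSmoothLimit_zero {Γ : Set (EuclideanSpace ℝ (Fin d))} {j : Fin d} :
    IsSmoothLimit Γ j 0 :=
  ⟨0, Submodule.zero_mem _, Lp.coeFn_zero _ _ _⟩

/-- The `L²` norm of a vector field is at most the sum of those of its coordinates. -/
theorem eLpNorm_le_sum_coord {μ : Measure (EuclideanSpace ℝ (Fin d))}
    {G : EuclideanSpace ℝ (Fin d) → EuclideanSpace ℝ (Fin d)}
    (hG : ∀ i, AEStronglyMeasurable (fun x => G x i) μ) :
    eLpNorm G 2 μ ≤ ∑ i, eLpNorm (fun x => G x i) 2 μ := by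
  have hsum : G = ∑ i, fun x => G x i • (EuclideanSpace.single i 1 : EuclideanSpace ℝ (Fin d)) := by
    ext x k
    simp [Finset.sum_apply, Pi.single_apply]
  conv_lhs => rw [hsum]
  refine (eLpNorm_sum_le (fun i _ => (hG i).smul aestronglyMeasurable_const)
    (by norm_num)).trans (Finset.sum_le_sum fun i _ => eLpNorm_mono fun x => ?_)
  rw [Pi.smul_apply', norm_smul, PiLp.norm_single, norm_one, mul_one]

/-- Extending `ζ U` by zero outside `Γ` may create a jump at the boundary, but mollifiers centred at
inward shifts do not see it from `Γ`. Their gradients on `Γ` are mollifications of the fields `H i`,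
hence bounded in L², while the functions converge. -/
theorem IsWeakGradient.isSmoothLimit_mul {Γ : Set (EuclideanSpace ℝ (Fin d))}
    (hΓ : IsOpen Γ) (hfr : volume (frontier Γ) = 0) {u : Lp ℝ 2 (closureMeasure Γ)}
    {g : Lp (EuclideanSpace ℝ (Fin d)) 2 (volume.restrict Γ)}
    (hug : IsWeakGradient Γ u g) {U : EuclideanSpace ℝ (Fin d) → ℝ} (hUm : Measurable U)
    (hUL : MemLp U 2) (hU : ∀ y : closure Γ, u y = U y) {ζ : EuclideanSpace ℝ (Fin d) → ℝ}
    (hζ : ContDiff ℝ ∞ ζ) (hζc : HasCompactSupport ζ)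
    (hshift : AdmitsInwardShifts Γ (tsupport ζ)) (j : Fin d) :
    IsSmoothLimit Γ j fun x => ζ x * U x := by
  set e : Fin d → EuclideanSpace ℝ (Fin d) := fun i => EuclideanSpace.single i 1 with he
  set V := Γ.indicator fun x => ζ x * U x with hV
  set H : Fin d → EuclideanSpace ℝ (Fin d) → ℝ := fun i =>
    Γ.indicator fun x => ζ x * g x i + U x * fderiv ℝ ζ x (e i) with hH
  have hζd : ∀ i, Continuous fun x => fderiv ℝ ζ x (e i) := fun i => by
    have := hζ.continuous_fderiv (by simp)
    fun_prop
  obtain ⟨C, hC⟩ := hζc.exists_bound_of_continuous hζ.continuous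
  have hVm : Measurable V := (hζ.continuous.measurable.mul hUm).indicator hΓ.measurableSet
  have hVL : MemLp V 2 := by
    refine MemLp.indicator hΓ.measurableSet (hUL.of_le_mul (c := C)
      (hζ.continuous.measurable.mul hUm).aestronglyMeasurable (Eventually.of_forall fun x => ?_))
    rw [norm_mul]
    gcongr
    exact hC x
  have hVloc : LocallyIntegrable V := hVL.locallyIntegrable (by norm_num)
  have hVc : HasCompactSupport V := by
    refine HasCompactSupport.intro hζc.isCompact fun x hx => ?_
    by_cases hxΓ : x ∈ Γ
    · rw [hV, Set.indicator_of_mem hxΓ, image_eq_zero_of_notMem_tsupport hx, zero_mul]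
    · rw [hV, Set.indicator_of_notMem hxΓ]
  have hgm : ∀ i, Measurable fun x => g x i := fun i =>
    (EuclideanSpace.proj (𝕜 := ℝ) i).continuous.measurable.comp (Lp.stronglyMeasurable g).measurable
  have hHm : ∀ i, Measurable (H i) := fun i =>
    ((hζ.continuous.measurable.mul (hgm i)).add (hUm.mul (hζd i).measurable)).indicator
      hΓ.measurableSet
  have hHL : ∀ i, MemLp (H i) 2 := by
    intro i
    obtain ⟨C', hC'⟩ := (hζc.fderiv_apply (𝕜 := ℝ) (e i)).exists_bound_of_continuous (hζd i)
    rw [hH, memLp_indicator_iff_restrict hΓ.measurableSet]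
    refine MemLp.add ((memLp_coord g i).of_le_mul (c := C)
      (hζ.continuous.measurable.mul (hgm i)).aestronglyMeasurable
      (Eventually.of_forall fun x => ?_)) ((hUL.restrict Γ).of_le_mul (c := C')
      (hUm.mul (hζd i).measurable).aestronglyMeasurable (Eventually.of_forall fun x => ?_))
    · rw [norm_mul]
      gcongr
      exact hC x
    · rw [norm_mul, mul_comm]
      gcongr
      exact hC' x
  set L := ContinuousLinearMap.lsmul ℝ ℝ (E := ℝ) with hL
  set v := (hVL.comp_val Γ).toLp with hv
  have hstep : ∀ ε : ℝ, 0 < ε → ∃ q ∈ collapsedGraph Γ ∅ j, ‖q.1 - v‖ ≤ ε ∧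
      ‖q.2‖ ≤ (∑ i, eLpNorm (H i) 2 volume).toReal := by
    intro ε hε
    obtain ⟨η, hη, hηV⟩ := hVL.exists_forall_eLpNorm_normed_convolution_sub_le hVm
      (ε := ENNReal.ofReal ε) (by simpa using hε)
    -- Half of `η` is reserved for the shift and the rest for the radius of the bump, which must
    -- also stay below `δ`.
    obtain ⟨b, hb, δ, hδ, hbδ⟩ := hshift (η / 2) (half_pos hη)
    let φ : ContDiffBump b := ⟨min δ (η / 2) / 4, min δ (η / 2) / 2, by positivity, by
      have : 0 < min δ (η / 2) := by positivity
      linarith⟩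
    have hφr : φ.rOut = min δ (η / 2) / 2 := rfl
    have hmin : 0 < min δ (η / 2) := by positivity
    have hφδ : φ.rOut < δ := by linarith [min_le_left δ (η / 2)]
    have hφη : ‖b‖ + φ.rOut < η := by linarith [min_le_right δ (η / 2)]
    set f := convolution (φ.normed volume) V L volume with hf
    have hfs : ContDiff ℝ ∞ f :=
      φ.hasCompactSupport_normed.contDiff_convolution_left _ φ.contDiff_normed hVloc
    have hfc : HasCompactSupport f := φ.hasCompactSupport_normed.convolution _ hVc
    obtain ⟨q, hq, hq1, hq2⟩ :=
      exists_mem_collapsedGraph Γ isCompact_empty interior_empty j hfs hfc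
    refine ⟨q, hq, ?_, ?_⟩
    · have h1 : q.1 - v =ᵐ[closureMeasure Γ] fun y => (f - V) y := by
        filter_upwards [Lp.coeFn_sub q.1 v, hq1, (hVL.comp_val Γ).coeFn_toLp] with y h1 h2 h3
        rw [h1, Pi.sub_apply, h2, h3, collapse_empty]
        rfl
      rw [Lp.norm_def, eLpNorm_congr_ae h1, eLpNorm_comp_val]
      exact ENNReal.toReal_le_of_le_ofReal hε.le
        ((eLpNorm_mono_measure _ Measure.restrict_le_self).trans (hηV b φ hφη))
    · rw [Lp.norm_def]
      refine ENNReal.toReal_mono (ENNReal.sum_ne_top.2 fun i _ => (hHL i).2.ne) ?_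
      refine (eLpNorm_le_sum_coord fun i => (memLp_coord q.2 i).1).trans
        (Finset.sum_le_sum fun i _ => ?_)
      have h2 : (fun x => q.2 x i) =ᵐ[volume.restrict Γ]
          convolution (φ.normed volume) (H i) L volume := by
        filter_upwards [hq2, ae_restrict_mem hΓ.measurableSet] with x hx hxΓ
        rw [hx, collapseGradient_apply, collapseDir_empty, collapse_empty, id]
        exact hug.fderiv_normed_convolution hΓ hUL hU hζ hζc φ (fun y hy hxy =>
          hbδ x hxΓ y (Metric.closedBall_subset_ball hφδ hy) hxy) i hVloc
      rw [eLpNorm_congr_ae h2]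
      exact (eLpNorm_mono_measure _ Measure.restrict_le_self).trans
        (φ.eLpNorm_normed_convolution_le (hHm i))
  choose q hqD hq1 hq2 using fun k : ℕ => hstep (1 / ((k : ℝ) + 1)) (by positivity)
  have hlim : Tendsto (fun k => (q k).1) atTop (𝓝 v) := by
    rw [tendsto_iff_norm_sub_tendsto_zero]
    exact squeeze_zero (fun k => norm_nonneg _) hq1 tendsto_one_div_add_atTop_nhds_zero_nat
  obtain ⟨h, hh, -⟩ := Submodule.exists_mem_of_tendsto_fst_of_norm_snd_le
    (Submodule.isClosed_topologicalClosure (collapsedGraph Γ ∅ j))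
    (fun k => Submodule.le_topologicalClosure _ (hqD k)) hlim hq2
  refine ⟨(v, h), hh, ?_⟩
  -- The limit was built from the extension by zero off `Γ`; it agrees with `ζ U` a.e. on the
  -- closure because the frontier is null.
  have hae : ∀ᵐ y : closure Γ ∂(closureMeasure Γ), (y : EuclideanSpace ℝ (Fin d)) ∉ frontier Γ :=
    ae_closureMeasure (p := fun x => x ∉ frontier Γ)
      (ae_restrict_of_ae (measure_eq_zero_iff_ae_notMem.1 hfr))
  filter_upwards [(hVL.comp_val Γ).coeFn_toLp, hae] with y h1 h2
  rw [h1, hV, Set.indicator_of_mem]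
  by_contra hy
  exact h2 ⟨y.2, by rwa [hΓ.interior_eq]⟩

end Mollified

end

/-! ### Density of smooth functions in H¹(Γ) -/

noncomputable section

section Density

/-- Smooth cutoff functions with uniformly bounded derivatives. -/
theorem exists_cutoff (E : Type*) [NormedAddCommGroup E] [InnerProductSpace ℝ E]
    [FiniteDimensional ℝ E] : ∃ C : ℝ, 0 ≤ C ∧ ∀ R : ℝ, ∃ χ : E → ℝ, ContDiff ℝ ∞ χ ∧
      HasCompactSupport χ ∧ (∀ x ∈ Metric.closedBall 0 R, χ x = 1) ∧
      (∀ x, χ x ∈ Set.Icc (0 : ℝ) 1) ∧ ∀ x, ‖fderiv ℝ χ x‖ ≤ C := by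
  obtain ⟨β, hβ, hβc, hβ1, hβ01⟩ : ∃ β : E → ℝ, ContDiff ℝ ∞ β ∧ HasCompactSupport β ∧
      (∀ x ∈ Metric.closedBall (0 : E) 1, β x = 1) ∧ ∀ x, β x ∈ Set.Icc (0 : ℝ) 1 := by
    let b : ContDiffBump (0 : E) := ⟨1, 2, one_pos, one_lt_two⟩
    exact ⟨b, b.contDiff, b.hasCompactSupport, fun x => b.one_of_mem_closedBall,
      fun x => ⟨b.nonneg, b.le_one⟩⟩
  obtain ⟨C, hC⟩ := (hβc.fderiv (𝕜 := ℝ)).exists_bound_of_continuous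
    (hβ.continuous_fderiv (by simp))
  have hC0 : 0 ≤ C := (norm_nonneg _).trans (hC 0)
  refine ⟨C, hC0, fun R => ?_⟩
  -- Dilating one fixed bump by a factor `c ≤ 1` can only shrink its derivative, so the bound does
  -- not depend on `R`.
  set c : ℝ := (max R 1)⁻¹ with hc
  have hR : 0 < max R 1 := lt_max_of_lt_right one_pos
  have hc0 : 0 < c := inv_pos.2 hR
  have hc1 : c ≤ 1 := inv_le_one_of_one_le₀ (le_max_right _ _)
  refine ⟨fun x => β (c • x), hβ.comp (contDiff_const_smul c),
    hβc.comp_smul hc0.ne', fun x hx => hβ1 _ ?_, fun x => hβ01 _,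
    fun x => ?_⟩
  · rw [mem_closedBall_zero_iff] at hx ⊢
    rw [norm_smul, Real.norm_of_nonneg hc0.le, hc, inv_mul_le_iff₀ hR, mul_one]
    exact hx.trans (le_max_left _ _)
  · have h : HasFDerivAt (fun x => β (c • x))
        ((fderiv ℝ β (c • x)).comp (c • ContinuousLinearMap.id ℝ E)) x :=
      HasFDerivAt.comp x ((hβ.differentiable (by simp)) (c • x)).hasFDerivAt
        ((hasFDerivAt_id x).const_smul c)
    rw [h.fderiv, ContinuousLinearMap.comp_smul, ContinuousLinearMap.comp_id, norm_smul,
      Real.norm_of_nonneg hc0.le]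
    exact (mul_le_of_le_one_left (norm_nonneg _) hc1).trans (hC _)

/-- The product rule bounds the weak gradient of a function multiplied by a cutoff function. -/
theorem IsWeakGradient.norm_le_of_ae_eq_mul {d : ℕ} {Γ : Set (EuclideanSpace ℝ (Fin d))}
    (hΓ : IsOpen Γ) {u q : Lp ℝ 2 (closureMeasure Γ)}
    {g h : Lp (EuclideanSpace ℝ (Fin d)) 2 (volume.restrict Γ)}
    (hug : IsWeakGradient Γ u g) {U : EuclideanSpace ℝ (Fin d) → ℝ} (hUm : Measurable U)
    (hUL : MemLp U 2) (hU : ∀ y : closure Γ, u y = U y)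
    {χ : EuclideanSpace ℝ (Fin d) → ℝ} (hχ : ContDiff ℝ ∞ χ) (hχc : HasCompactSupport χ)
    (hχ01 : ∀ x, χ x ∈ Set.Icc (0 : ℝ) 1) {C : ℝ} (hC0 : 0 ≤ C) (hχd : ∀ x, ‖fderiv ℝ χ x‖ ≤ C)
    (hqh : IsWeakGradient Γ q h) (hq : q =ᵐ[closureMeasure Γ] fun y => χ y * U y) :
    ‖h‖ ≤ ‖g‖ + d * C * (eLpNorm U 2 volume).toReal := by
  have hgm := (Lp.stronglyMeasurable g).measurable
  set e : Fin d → EuclideanSpace ℝ (Fin d) := fun i => EuclideanSpace.single i 1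
  have hχe : ∀ i, Continuous fun x => fderiv ℝ χ x (e i) := fun i => by
    have := hχ.continuous_fderiv (by simp)
    fun_prop
  have hχe' : ∀ i x, ‖fderiv ℝ χ x (e i)‖ ≤ C := fun i x => by
    refine ((fderiv ℝ χ x).le_opNorm _).trans ?_
    rw [PiLp.norm_single, norm_one, mul_one]
    exact hχd x
  -- This is the field `U ∇χ`. By the product rule and uniqueness, `h` equals `χ g + D`.
  set D : EuclideanSpace ℝ (Fin d) → EuclideanSpace ℝ (Fin d) := fun x =>
    ∑ i, (U x * fderiv ℝ χ x (e i)) • e i with hD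
  have hDn : ∀ x, ‖D x‖ ≤ d * C * ‖U x‖ := by
    intro x
    refine (norm_sum_le _ _).trans ?_
    have : ∀ i ∈ Finset.univ, ‖(U x * fderiv ℝ χ x (e i)) • e i‖ ≤ C * ‖U x‖ := by
      intro i _
      rw [norm_smul, PiLp.norm_single, norm_one, mul_one, norm_mul, mul_comm]
      gcongr
      exact hχe' i x
    refine (Finset.sum_le_card_nsmul _ _ _ this).trans_eq ?_
    simp
    ring
  have hDm : Measurable D := by
    refine Finset.measurable_sum _ fun i _ => ?_
    exact (hUm.mul (hχe i).measurable).smul_const _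
  have hDL : MemLp D 2 (volume.restrict Γ) :=
    (hUL.restrict Γ).of_le_mul hDm.aestronglyMeasurable (Eventually.of_forall hDn)
  have hgL : MemLp (fun x => χ x • g x) 2 (volume.restrict Γ) := by
    refine (Lp.memLp g).of_le (hχ.continuous.measurable.smul hgm).aestronglyMeasurable
      (Eventually.of_forall fun x => ?_)
    rw [norm_smul, Real.norm_of_nonneg (hχ01 x).1]
    exact mul_le_of_le_one_left (norm_nonneg _) (hχ01 x).2
  have hweak : IsWeakGradient Γ q (hgL.toLp + hDL.toLp) := by
    intro φ hφ hφc hφs i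
    have hs : tsupport (fun x => χ x * φ x) ⊆ Γ := tsupport_mul_subset_right.trans hφs
    have h1 := hug.setIntegral_mul hUL hU hχ hχc hφ hs i
    rw [integral_congr_ae (g := fun y : closure Γ =>
        χ y * U y * fderiv ℝ φ y (EuclideanSpace.single i 1)),
      setIntegral_closureMeasure
        (fun x => χ x * U x * fderiv ℝ φ x (EuclideanSpace.single i 1)), h1]
    · congr 1
      refine integral_congr_ae ?_
      filter_upwards [Lp.coeFn_add hgL.toLp hDL.toLp, hgL.coeFn_toLp, hDL.coeFn_toLp]
        with x h2 h3 h4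
      rw [h2, Pi.add_apply, h3, h4]
      simp [hD, e, Pi.single_apply]
    · filter_upwards [ae_restrict_of_ae hq] with y hy
      rw [hy]
  have heq : h = hgL.toLp + hDL.toLp := hqh.unique hΓ hweak
  rw [heq]
  refine (norm_add_le _ _).trans (add_le_add ?_ ?_)
  · refine Lp.norm_le_norm_of_ae_le ?_
    filter_upwards [hgL.coeFn_toLp] with x hx
    rw [hx, norm_smul, Real.norm_of_nonneg (hχ01 x).1]
    exact mul_le_of_le_one_left (norm_nonneg _) (hχ01 x).2
  · rw [Lp.norm_toLp]
    have hnC : 0 ≤ (d : ℝ) * C := by positivity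
    have h1 := eLpNorm_le_mul_eLpNorm_of_ae_le_mul (μ := volume.restrict Γ) (p := 2)
      (Eventually.of_forall hDn)
    have h2 := h1.trans (mul_le_mul_right (eLpNorm_mono_measure U
      (Measure.restrict_le_self (s := Γ))) _)
    have h3 := ENNReal.toReal_mono (ENNReal.mul_ne_top ENNReal.ofReal_ne_top hUL.2.ne) h2
    rwa [ENNReal.toReal_mul, ENNReal.toReal_ofReal hnC] at h3

variable {n : ℕ} {Γ : Set (EuclideanSpace ℝ (Fin (n + 1)))}

/-- A function with a weak gradient, multiplied by a cutoff function, is a limit of smooth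
functions. -/
theorem IsWeakGradient.isSmoothLimit_mul_of_hasContinuousBoundary (hΓ : IsOpen Γ)
    (hbdry : HasContinuousBoundary Γ) {u : Lp ℝ 2 (closureMeasure Γ)}
    {g : Lp (EuclideanSpace ℝ (Fin (n + 1))) 2 (volume.restrict Γ)}
    (hug : IsWeakGradient Γ u g) {U : EuclideanSpace ℝ (Fin (n + 1)) → ℝ} (hUm : Measurable U)
    (hUL : MemLp U 2) (hU : ∀ y : closure Γ, u y = U y)
    {χ : EuclideanSpace ℝ (Fin (n + 1)) → ℝ} (hχ : ContDiff ℝ ∞ χ) (hχc : HasCompactSupport χ)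
    (j : Fin (n + 1)) : IsSmoothLimit Γ j fun x => χ x * U x := by
  -- Inward shifts exist only locally, with a direction depending on the point; a partition of unity
  -- on the support of `χ` reduces to finitely many such pieces.
  choose O hO hxO hOk using fun x => hbdry.exists_isOpen_forall_admitsInwardShifts hΓ x
  obtain ⟨t, ht⟩ := hχc.isCompact.elim_finite_subcover O hO
    fun x _ => Set.mem_iUnion.2 ⟨x, hxO x⟩
  obtain ⟨ζ, hζ⟩ := SmoothPartitionOfUnity.exists_isSubordinate
    (modelWithCornersSelf ℝ (EuclideanSpace ℝ (Fin (n + 1)))) (isClosed_tsupport χ)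
    (fun x : t => O x) (fun x => hO x) (by simpa [Set.iUnion_subtype] using ht)
  have hζs : ∀ i, ContDiff ℝ ∞ (ζ i) := fun i => (ζ i).contMDiff.contDiff
  have hsum : (fun x => χ x * U x) = ∑ i, fun x => (χ x * ζ i x) * U x := by
    ext x
    rw [Finset.sum_apply, ← Finset.sum_mul, ← Finset.mul_sum]
    by_cases hx : x ∈ tsupport χ
    · have h1 := ζ.sum_eq_one hx
      rw [finsum_eq_sum_of_fintype] at h1
      rw [h1, mul_one]
    · rw [image_eq_zero_of_notMem_tsupport hx, zero_mul, zero_mul, zero_mul]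
  rw [hsum]
  refine Finset.sum_induction _ (IsSmoothLimit Γ j) (fun _ _ => IsSmoothLimit.add)
    isSmoothLimit_zero fun i _ => ?_
  have hc : HasCompactSupport fun x => χ x * ζ i x := hχc.mul_right
  refine hug.isSmoothLimit_mul hΓ (hbdry.measure_frontier hΓ) hUm hUL hU (hχ.mul (hζs i)) hc
    (hOk i _ ?_ hc) j
  exact (tsupport_mul_subset_right).trans (hζ i)

/-- Restrictions of smooth compactly supported functions are dense in `H¹(Γ)`. -/
theorem weakGradientGraph_le_closure (hΓ : IsOpen Γ) (hbdry : HasContinuousBoundary Γ)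
    (j : Fin (n + 1)) : weakGradientGraph Γ ≤ (collapsedGraph Γ ∅ j).topologicalClosure := by
  rintro ⟨u, g⟩ hug
  replace hug : IsWeakGradient Γ u g := hug
  obtain ⟨U, hUm, hUL, hU⟩ := exists_measurable_extension u
  obtain ⟨C, hC0, hcut⟩ := exists_cutoff (EuclideanSpace ℝ (Fin (n + 1)))
  have hstep : ∀ ε : ℝ, 0 < ε → ∃ q ∈ (collapsedGraph Γ ∅ j).topologicalClosure,
      ‖q.1 - u‖ ≤ ε ∧ ‖q.2‖ ≤ ‖g‖ + (n + 1) * C * (eLpNorm U 2 volume).toReal := by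
    intro ε hε
    -- The function `h` only measures the tail of `U`: outside its support `|χ U - U| ≤ |U - h|`,
    -- and on its support `χ = 1`.
    obtain ⟨h, hhc, hUh, hh, hhL⟩ := hUL.exists_hasCompactSupport_eLpNorm_sub_le
      (by norm_num) (ε := ENNReal.ofReal ε) (by simpa using hε)
    obtain ⟨R, hR⟩ := hhc.isCompact.isBounded.subset_closedBall 0
    obtain ⟨χ, hχ, hχc, hχ1, hχ01, hχd⟩ := hcut R
    obtain ⟨q, hq, hq1⟩ := hug.isSmoothLimit_mul_of_hasContinuousBoundary hΓ hbdry hUm hUL hU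
      hχ hχc j
    refine ⟨q, hq, ?_, ?_⟩
    · have h1 : q.1 - u =ᵐ[closureMeasure Γ] fun y => χ y * U y - U y := by
        filter_upwards [Lp.coeFn_sub q.1 u, hq1] with y h1 h2
        rw [h1, Pi.sub_apply, h2, hU]
      rw [Lp.norm_def, eLpNorm_congr_ae h1, eLpNorm_comp_val (fun x => χ x * U x - U x)]
      refine ENNReal.toReal_le_of_le_ofReal hε.le
        ((eLpNorm_mono_measure _ Measure.restrict_le_self).trans
          ((eLpNorm_mono fun x => ?_).trans hUh))
      by_cases hx : x ∈ tsupport h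
      · rw [hχ1 x (hR hx), one_mul, sub_self, norm_zero]
        exact norm_nonneg _
      · have h0 : χ x * U x - U x = (χ x - 1) * U x := by ring
        rw [Pi.sub_apply, image_eq_zero_of_notMem_tsupport hx, sub_zero, h0, norm_mul]
        refine mul_le_of_le_one_left (norm_nonneg _) ?_
        rw [Real.norm_eq_abs, abs_le]
        constructor <;> linarith [(hχ01 x).1, (hχ01 x).2]
    · have := hug.norm_le_of_ae_eq_mul hΓ hUm hUL hU hχ hχc hχ01 hC0 hχd
        (closure_collapsedGraph_le hΓ isCompact_empty j hq) hq1
      simpa using this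
  choose q hqW hq1 hq2 using fun k : ℕ => hstep (1 / ((k : ℝ) + 1)) (by positivity)
  have hlim : Tendsto (fun k => (q k).1) atTop (𝓝 u) := by
    rw [tendsto_iff_norm_sub_tendsto_zero]
    exact squeeze_zero (fun k => norm_nonneg _) hq1 tendsto_one_div_add_atTop_nhds_zero_nat
  obtain ⟨h, hh, -⟩ := Submodule.exists_mem_of_tendsto_fst_of_norm_snd_le
    (Submodule.isClosed_topologicalClosure (collapsedGraph Γ ∅ j)) hqW hlim hq2
  -- The limiting second component is only known to exist; uniqueness identifies it with the given
  -- gradient.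
  have : h = g :=
    IsWeakGradient.unique hΓ (closure_collapsedGraph_le hΓ isCompact_empty j hh) hug
  rwa [this] at hh

end Density

/-! ### The collapsed form and the conclusion -/

section Main

variable {d : ℕ} {Γ : Set (EuclideanSpace ℝ (Fin d))}

theorem reflectingForm_form (hΓ : IsOpen Γ) {u v : (reflectingForm Γ).domain}
    {g h : Lp (EuclideanSpace ℝ (Fin d)) 2 (volume.restrict Γ)} (hg : IsWeakGradient Γ u g)
    (hh : IsWeakGradient Γ v h) : (reflectingForm Γ).form u v = (1 / 2) * inner ℝ g h := by
  have e1 : weakGradient Γ u = g := ((weakGradient_spec hΓ).2 u).unique hΓ hg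
  have e2 : weakGradient Γ v = h := ((weakGradient_spec hΓ).2 v).unique hΓ hh
  rw [← e1, ← e2, L2.inner_def]
  rfl

/-- The restriction of the form `½ D_Γ` to the closure of the functions `f ∘ collapse K j`, with
`f` smooth and compactly supported. -/
def collapsedForm (Γ : Set (EuclideanSpace ℝ (Fin d))) (K : Set ℝ) (j : Fin d)
    (h : (collapsedGraph Γ K j).topologicalClosure ≤ weakGradientGraph Γ) :
    L2Form (closureMeasure Γ) where
  domain := (collapsedGraph Γ K j).topologicalClosure.map (LinearMap.fst ℝ _ _)
  form :=
    have hle : (collapsedGraph Γ K j).topologicalClosure.map (LinearMap.fst ℝ _ _)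
      ≤ (reflectingForm Γ).domain := Submodule.map_mono h
    (reflectingForm Γ).form.compl₁₂ (Submodule.inclusion hle) (Submodule.inclusion hle)

theorem mem_collapsedForm_domain {K : Set ℝ} {j : Fin d}
    (h : (collapsedGraph Γ K j).topologicalClosure ≤ weakGradientGraph Γ)
    (u : Lp ℝ 2 (closureMeasure Γ)) : u ∈ (collapsedForm Γ K j h).domain ↔
      ∃ g, (u, g) ∈ (collapsedGraph Γ K j).topologicalClosure := by
  simp only [collapsedForm, Submodule.mem_map, LinearMap.fst_apply]
  exact ⟨fun ⟨p, hp, hpu⟩ => ⟨p.2, hpu ▸ hp⟩, fun ⟨g, hg⟩ => ⟨(u, g), hg, rfl⟩⟩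

end Main

end

theorem proposition3p9 (n : ℕ) (Γ : Set (EuclideanSpace ℝ (Fin (n + 1))))
    (hopen : IsOpen Γ) (hconn : IsConnected Γ) (hbdry : HasContinuousBoundary Γ) :
    ∃ Q' : L2Form (closureMeasure Γ),
      Q'.IsProperRegularSubspace (reflectingForm Γ) := by
  obtain ⟨K, hK, hKi, p, hp, hpK⟩ :=
    exists_mem_collapsedGraph_empty_notMem_closure hopen hconn.nonempty 0
  have hle := closure_collapsedGraph_le hopen hK (0 : Fin (n + 1))
  have hdom := mem_collapsedForm_domain hle
  have hsub : (collapsedForm Γ K 0 hle).domain ≤ (reflectingForm Γ).domain :=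
    Submodule.map_mono hle
  refine ⟨collapsedForm Γ K 0 hle, ⟨?_, ?_, hsub, fun u v => rfl⟩, fun heq => ?_⟩
  · refine L2Form.isRegularDirichletForm_of_mem_domain_iff hopen hK hKi 0 _ hdom
      fun u v g h hg hh => ?_
    exact reflectingForm_form hopen (u := Submodule.inclusion hsub u)
      (v := Submodule.inclusion hsub v) hg hh
  -- For `K = ∅` the collapse is the identity, and density identifies the closure of the core with
  -- all of H¹(Γ).
  · refine L2Form.isRegularDirichletForm_of_mem_domain_iff hopen isCompact_empty interior_empty 0 _
      (fun u => ?_) fun u v g h hg hh => reflectingForm_form hopen hg hh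
    refine ((weakGradient_spec hopen).1 u).trans (exists_congr fun g => ?_)
    exact ⟨fun h => weakGradientGraph_le_closure hopen hbdry 0 h,
      fun h => closure_collapsedGraph_le hopen isCompact_empty 0 h⟩
  -- If the domains agreed, `p.1` would occur in the collapsed closure with some gradient,
  -- necessarily `p.2`, contrary to the choice of `p`.
  · have hpg : IsWeakGradient Γ p.1 p.2 := collapsedGraph_le Γ isCompact_empty 0 hp
    have hmem : p.1 ∈ (reflectingForm Γ).domain := ((weakGradient_spec hopen).1 p.1).2 ⟨_, hpg⟩
    rw [← heq, hdom] at hmem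
    obtain ⟨g, hg⟩ := hmem
    have hgp : g = p.2 := IsWeakGradient.unique hopen (hle hg) hpg
    rw [hgp] at hg
    exact hpK hg
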